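/- For $b>0$ and an entire function $f$ put $\|f\|_b=\sup_{k\ge 0} b^{-k}|f^{(k)}(0)|$, and for $a\ge 0$ let $\mathcal A_a$ be the space of all entire functions $f$ with $\|f\|_b<\infty$ for every $b>a$, with the topology defined by the norms $\|\cdot\|_b$, $b>a$. Let $\mathcal L^+$ (the Laguerre entire functions) be the set of all entire functions of the form $$f(z)=Cz^l e^{\alpha z}\prod_{j=1}^\infty(1+\beta_j z),\qquad C\in\mathbb C,\ l\in\mathbb N_0,\ \alpha\ge 0,\ \beta_j\ge\beta_{j+1}\ge 0,\ \sum_{j=1}^\infty\beta_j<\infty,$$ and let $\mathcal L^+_a=\mathcal L^+\cap\mathcal A_a$ carry the topology induced from $\mathcal A_a$. For $\theta\ge 0$ let $\Delta_\theta=(\theta+zD)D$ with $D=d/dz$, and for entire $\varphi,f$ let $$\varphi(\Delta_\theta)f(z)=\sum_{k=0}^\infty\sum_{m=0}^\infty\frac{\varphi^{(k)}(0)}{k!}\,\frac{f^{(m)}(0)}{m!}\,\Delta_\theta^k z^m .$$ **Theorem 3.** Let $\theta\ge 0$, $a\ge 0$ and $b\ge 0$ with $ab<1$, and put $c=b(1-ab)^{-1}$.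 For all $\varphi\in\mathcal L^+_a$ and $f\in\mathcal L^+_b$ the double series $\varphi(\Delta_\theta)f(z)$ converges absolutely for every $z\in\mathbb C$, its sum belongs to $\mathcal L^+_c$, and $(\varphi,f)\mapsto\varphi(\Delta_\theta)f$ is a continuous map from $\mathcal L^+_a\times\mathcal L^+_b$ into $\mathcal L^+_c$. -/

import Mathlib

open scoped ENNReal

noncomputable section

/-- The norm `‖f‖_b = sup_k b^{-k} |f^{(k)}(0)|`, with values in `[0, ∞]` (used for `b > 0`). -/
def expNorm (b : ℝ) (f : ℂ → ℂ) : ℝ≥0∞ :=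
  ⨆ k : ℕ, ‖iteratedDeriv k f 0‖ₑ / ENNReal.ofReal b ^ k

theorem expNorm_zero (b : ℝ) : expNorm b (0 : ℂ → ℂ) = 0 := by
  have h : ∀ k : ℕ, iteratedDeriv k (0 : ℂ → ℂ) 0 = 0 := by
    intro k
    have : (0 : ℂ → ℂ) = fun _ => (0 : ℂ) := rfl
    rw [this, iteratedDeriv_const]
    split_ifs <;> rfl
  simp [expNorm, h]

theorem expNorm_add_le (b : ℝ) {f g : ℂ → ℂ} (hf : Differentiable ℂ f)
    (hg : Differentiable ℂ g) : expNorm b (f + g) ≤ expNorm b f + expNorm b g := by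
  refine iSup_le fun k => ?_
  rw [iteratedDeriv_add hf.contDiff.contDiffAt hg.contDiff.contDiffAt]
  calc ‖iteratedDeriv k f 0 + iteratedDeriv k g 0‖ₑ / ENNReal.ofReal b ^ k
      ≤ (‖iteratedDeriv k f 0‖ₑ + ‖iteratedDeriv k g 0‖ₑ) / ENNReal.ofReal b ^ k :=
        ENNReal.div_le_div_right (enorm_add_le _ _) _
    _ = ‖iteratedDeriv k f 0‖ₑ / ENNReal.ofReal b ^ k
          + ‖iteratedDeriv k g 0‖ₑ / ENNReal.ofReal b ^ k := ENNReal.add_div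
    _ ≤ expNorm b f + expNorm b g :=
        add_le_add (le_iSup (fun k : ℕ => ‖iteratedDeriv k f 0‖ₑ / ENNReal.ofReal b ^ k) k)
          (le_iSup (fun k : ℕ => ‖iteratedDeriv k g 0‖ₑ / ENNReal.ofReal b ^ k) k)

theorem expNorm_smul (b : ℝ) (c : ℂ) {f : ℂ → ℂ} (hf : Differentiable ℂ f) :
    expNorm b (c • f) = ‖c‖ₑ * expNorm b f := by
  unfold expNorm
  rw [ENNReal.mul_iSup]
  congr 1
  funext k
  rw [iteratedDeriv_const_smul hf.contDiff.contDiffAt c, smul_eq_mul, enorm_mul, mul_div_assoc]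

/-- The vector space of all entire functions `f` with `‖f‖_b < ∞` for every `b > a`. -/
def expSubmodule (a : ℝ) : Submodule ℂ (ℂ → ℂ) where
  carrier := {f | Differentiable ℂ f ∧ ∀ b : ℝ, a < b → expNorm b f < ∞}
  zero_mem' := ⟨differentiable_const 0, fun b _ => by rw [expNorm_zero]; exact ENNReal.zero_lt_top⟩
  add_mem' := fun hf hg => ⟨hf.1.add hg.1, fun b hb =>
    (expNorm_add_le b hf.1 hg.1).trans_lt (ENNReal.add_lt_top.2 ⟨hf.2 b hb, hg.2 b hb⟩)⟩
  smul_mem' := fun c f hf => ⟨hf.1.const_smul c, fun b hb => by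
    rw [expNorm_smul b c hf.1]; exact ENNReal.mul_lt_top enorm_lt_top (hf.2 b hb)⟩

/-- The space `𝓐_a`: the underlying type of `expSubmodule a`, as a separate type so that it carries
the topology of the norms `‖·‖_b`, `b > a`, and not that of pointwise convergence. -/
def ExpSpace (a : ℝ) : Type := expSubmodule a

namespace ExpSpace

variable {a : ℝ}

instance : AddCommGroup (ExpSpace a) := inferInstanceAs (AddCommGroup (expSubmodule a))

instance : Module ℂ (ExpSpace a) := inferInstanceAs (Module ℂ (expSubmodule a))

/-- The entire function underlying an element of `𝓐_a`. -/
def toFun (f : ExpSpace a) : ℂ → ℂ := Subtype.val f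

theorem differentiable_toFun (f : ExpSpace a) : Differentiable ℂ f.toFun :=
  (Subtype.property f).1

theorem expNorm_lt_top (f : ExpSpace a) {b : ℝ} (hb : a < b) : expNorm b f.toFun < ∞ :=
  (Subtype.property f).2 b hb

/-- The norms `‖·‖_b`, `b > a`, on `𝓐_a`. -/
def seminorms (a : ℝ) : SeminormFamily ℂ (ExpSpace a) (Set.Ioi a) := fun b =>
  Seminorm.of (fun f => (expNorm b f.toFun).toReal)
    (fun f g => by
      rw [← ENNReal.toReal_add (f.expNorm_lt_top b.2).ne (g.expNorm_lt_top b.2).ne]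
      exact ENNReal.toReal_mono
        (ENNReal.add_lt_top.2 ⟨f.expNorm_lt_top b.2, g.expNorm_lt_top b.2⟩).ne
        (expNorm_add_le b f.differentiable_toFun g.differentiable_toFun))
    (fun c f => by
      change (expNorm b (c • f.toFun)).toReal = _
      rw [expNorm_smul b c f.differentiable_toFun, ENNReal.toReal_mul, toReal_enorm])

/-- The topology on `𝓐_a` defined by the family of norms `‖·‖_b`, `b > a`. -/
instance : TopologicalSpace (ExpSpace a) := (seminorms a).moduleFilterBasis.topology

theorem withSeminorms (a : ℝ) : WithSeminorms (seminorms a) := ⟨rfl⟩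

end ExpSpace

/-- The Laguerre entire functions:
`f(z) = C z^l exp(α z) ∏_j (1 + β_j z)` with `C ∈ ℂ`, `l ∈ ℕ`, `α ≥ 0`, `β_j ≥ β_{j+1} ≥ 0` and
`∑_j β_j < ∞`. -/
def laguerreEntire : Set (ℂ → ℂ) :=
  {f | Differentiable ℂ f ∧ ∃ (C : ℂ) (l : ℕ) (α : ℝ) (β : ℕ → ℝ),
    0 ≤ α ∧ Antitone β ∧ (∀ j, 0 ≤ β j) ∧ Summable β ∧
    ∀ z : ℂ, f z = C * z ^ l * Complex.exp (α * z) * ∏' j : ℕ, (1 + (β j : ℂ) * z)}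

/-- The set `𝓛⁺_a = 𝓛⁺ ∩ 𝓐_a`, as a subset of the space `𝓐_a`. -/
def laguerreExp (a : ℝ) : Set (ExpSpace a) := {f | f.toFun ∈ laguerreEntire}

/-- The operator `Δ_θ = (θ + z D) D`. -/
def laguerreDelta (θ : ℝ) (f : ℂ → ℂ) : ℂ → ℂ :=
  fun z => θ * deriv f z + z * deriv (deriv f) z

/-- The `(k, m)` term, at the point `z`, of the double series which defines `φ(Δ_θ) f`:
`(φ^{(k)}(0) / k!) (f^{(m)}(0) / m!) (Δ_θ^k ζ^m)(z)`. -/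
def deltaSeriesTerm (θ : ℝ) (φ f : ℂ → ℂ) (z : ℂ) (p : ℕ × ℕ) : ℂ :=
  (iteratedDeriv p.1 φ 0 / (p.1.factorial : ℂ)) * (iteratedDeriv p.2 f 0 / (p.2.factorial : ℂ)) *
    ((laguerreDelta θ)^[p.1] (fun ζ : ℂ => ζ ^ p.2)) z

/-- The function `φ(Δ_θ) f`. -/
def deltaApply (θ : ℝ) (φ f : ℂ → ℂ) (z : ℂ) : ℂ :=
  ∑' p : ℕ × ℕ, deltaSeriesTerm θ φ f z p

end

/-! Two facts are combined: polynomials in `Δ_θ` with nonpositive zeros preserve nonpositivity of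
zeros, and the double series obeys explicit Taylor bounds that allow passage to the limit.

Zeros. Nonpositive zeros of `p` mean `p(z²) ≠ 0` for `Re z > 0`. There `z p'(z²)/p(z²)` is a sum of
terms `z/(z² + t²)`, all in the right half-plane. After division by `z p'(z²)`, the polynomial `κ p
+ τ Δ_θ p` becomes a sum of terms with nonnegative real part, so it cannot vanish except in
degenerate cases (`NonposRooted.affine_polyDelta`). Composing such factors gives the result for
`q(Δ_θ) p`.

Limits. A Laguerre entire function is, up to a constant, a limit of products of factors `κ + τ z`,
with nonnegative coefficients increasing to those of the limit (`exists_affineProducts_approx`).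
Dominated convergence transfers this to `φ(Δ_θ) f`, and Laguerre's theorem
(`mem_laguerreEntire_of_tendsto`) returns the product form.

Growth. On monomials `Δ_θ^k` is explicit; the `n`-th Taylor coefficient is dominated by a negative
binomial series with sum a constant times `(b / (1 - a b))^n / n!` (`hasSum_deltaTaylorTerm_bound`).
This yields absolute convergence, the exponent `c`, and a bilinear bound implying continuity. -/

open Polynomial Filter Topology

/-! ### Polynomials with nonpositive zeros under `Δ_θ` -/

/-- A real polynomial without complex zeros off the half-line `(-∞, 0]`. -/
def NonposRooted (p : ℝ[X]) : Prop :=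
  ∀ z : ℂ, 0 < z.re → aeval (z ^ 2) p ≠ 0

theorem NonposRooted.ne_zero {p : ℝ[X]} (hp : NonposRooted p) : p ≠ 0 := by
  rintro rfl
  exact hp 1 (by simp) (by simp)

/-- Neither square root of a zero lies in the open right half-plane, so both are purely imaginary.
-/
theorem NonposRooted.exists_root_eq {p : ℝ[X]} (hp : NonposRooted p) {w : ℂ}
    (hw : aeval w p = 0) : ∃ t : ℝ, w = -(t : ℂ) ^ 2 := by
  obtain ⟨s, hs⟩ := IsAlgClosed.exists_pow_nat_eq w (n := 2) (by norm_num)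
  have h1 : ¬ 0 < s.re := fun h => hp s h (by rw [hs, hw])
  have h2 : ¬ 0 < (-s).re := fun h => hp (-s) h (by rw [neg_sq, hs, hw])
  have h3 : s.re = 0 := by
    rw [Complex.neg_re] at h2
    linarith
  refine ⟨s.im, ?_⟩
  rw [← hs, ← Complex.re_add_im s, h3]
  simp [mul_pow]

/-- The number is the reciprocal of `z + t²/z`, whose two summands have real parts of the right
sign. -/
theorem re_div_sq_add_sq_pos {z : ℂ} (hz : 0 < z.re) (t : ℝ) :
    0 < (z * (1 / (z ^ 2 - -(t : ℂ) ^ 2))).re := by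
  have hz0 : z ≠ 0 := by
    rintro rfl
    simp at hz
  have h1 : z ^ 2 - -(t : ℂ) ^ 2 = z * (z + (t ^ 2 : ℝ) / z) := by
    field_simp
    push_cast
    ring
  have h2 : 0 < (z + ((t ^ 2 : ℝ) : ℂ) / z).re := by
    rw [Complex.add_re, div_eq_mul_inv, Complex.re_ofReal_mul, Complex.inv_re]
    have : 0 ≤ t ^ 2 * (z.re / Complex.normSq z) := by
      have := Complex.normSq_nonneg z
      positivity
    linarith
  rw [h1, one_div, mul_inv, mul_inv_cancel_left₀ hz0, Complex.inv_re]
  refine div_pos h2 (Complex.normSq_pos.2 fun h => ?_)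
  rw [h] at h2
  simp at h2

theorem Multiset.re_sum_nonneg {s : Multiset ℂ} (h : ∀ w ∈ s, 0 < w.re) : 0 ≤ s.sum.re := by
  induction s using Multiset.induction_on with
  | empty => simp
  | cons a s ih =>
    rw [Multiset.sum_cons, Complex.add_re]
    exact add_nonneg (h a (Multiset.mem_cons_self a s)).le
      (ih fun w hw => h w (Multiset.mem_cons_of_mem hw))

theorem Multiset.re_sum_pos {s : Multiset ℂ} (h : ∀ w ∈ s, 0 < w.re) (hs : s ≠ 0) :
    0 < s.sum.re := by
  obtain ⟨a, ha⟩ := Multiset.exists_mem_of_ne_zero hs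
  obtain ⟨t, rfl⟩ := Multiset.exists_cons_of_mem ha
  rw [Multiset.sum_cons, Complex.add_re]
  exact add_pos_of_pos_of_nonneg (h a ha)
    (Multiset.re_sum_nonneg fun w hw => h w (Multiset.mem_cons_of_mem hw))

/-- Partial fractions of `p'/p` at `z²`; the extra factor `z` is what puts every term in the right
half-plane. -/
theorem NonposRooted.logDeriv_eq_sum {p : ℝ[X]} (hp : NonposRooted p) {z : ℂ} (hz : 0 < z.re) :
    ∃ s : Multiset ℂ, (∀ w ∈ s, 0 < w.re) ∧ s.card = p.natDegree ∧
      z * (aeval (z ^ 2) (derivative p) / aeval (z ^ 2) p) = s.sum := by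
  set q : ℂ[X] := p.map (algebraMap ℝ ℂ) with hq
  have hsplit : q.Splits := IsAlgClosed.splits q
  refine ⟨q.roots.map fun w => z * (1 / (z ^ 2 - w)), ?_, ?_, ?_⟩
  · intro w hw
    obtain ⟨x, hx, rfl⟩ := Multiset.mem_map.1 hw
    have hx' : aeval x p = 0 := by
      have := (mem_roots'.1 hx).2
      rwa [hq, IsRoot, eval_map_algebraMap] at this
    obtain ⟨t, rfl⟩ := hp.exists_root_eq hx'
    exact re_div_sq_add_sq_pos hz t
  · rw [Multiset.card_map, ← hsplit.natDegree_eq_card_roots, hq, natDegree_map]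
  · have h0 : q.eval (z ^ 2) ≠ 0 := by
      rw [hq, eval_map_algebraMap]
      exact hp z hz
    rw [Multiset.sum_map_mul_left, ← hsplit.eval_derivative_div_eval_of_ne_zero h0, hq,
      derivative_map, eval_map_algebraMap, eval_map_algebraMap]

theorem NonposRooted.re_logDeriv_nonneg {p : ℝ[X]} (hp : NonposRooted p) {z : ℂ}
    (hz : 0 < z.re) : 0 ≤ (z * (aeval (z ^ 2) (derivative p) / aeval (z ^ 2) p)).re := by
  obtain ⟨s, hs, -, h⟩ := hp.logDeriv_eq_sum hz
  rw [h]
  exact Multiset.re_sum_nonneg hs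

theorem NonposRooted.re_logDeriv_pos {p : ℝ[X]} (hp : NonposRooted p) {z : ℂ}
    (hz : 0 < z.re) (hd : p.natDegree ≠ 0) :
    0 < (z * (aeval (z ^ 2) (derivative p) / aeval (z ^ 2) p)).re := by
  obtain ⟨s, hs, hc, h⟩ := hp.logDeriv_eq_sum hz
  rw [h]
  exact Multiset.re_sum_pos hs (by rw [← Multiset.card_pos, hc]; omega)

theorem NonposRooted.derivative {p : ℝ[X]} (hp : NonposRooted p) (hd : p.natDegree ≠ 0) :
    NonposRooted (derivative p) := by
  intro z hz h
  have := hp.re_logDeriv_pos hz hd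
  rw [h] at this
  simp at this

/-- The operator `(θ + X D) D` on real polynomials. -/
noncomputable def polyDelta (θ : ℝ) : ℝ[X] →ₗ[ℝ] ℝ[X] :=
  θ • derivative + LinearMap.mulLeft ℝ X ∘ₗ derivative ∘ₗ derivative

theorem polyDelta_apply (θ : ℝ) (p : ℝ[X]) :
    polyDelta θ p = C θ * derivative p + X * derivative (derivative p) := by
  simp [polyDelta, smul_eq_C_mul]

/-- The core of the argument: at `z²`, division by `z p'` turns the polynomial into `κ (z p'/p)⁻¹ +
τ (θ/z + z p''/p')`, and no summand has negative real part. -/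
theorem NonposRooted.affine_polyDelta {p : ℝ[X]} (hp : NonposRooted p) {θ κ τ : ℝ} (hθ : 0 ≤ θ)
    (hκ : 0 ≤ κ) (hτ : 0 ≤ τ) :
    κ • p + τ • polyDelta θ p = 0 ∨ NonposRooted (κ • p + τ • polyDelta θ p) := by
  have hconst : ∀ q : ℝ[X], NonposRooted q → κ • q = 0 ∨ NonposRooted (κ • q) := by
    intro q hq
    rcases hκ.eq_or_lt with rfl | hκ
    · simp
    · refine Or.inr fun z hz h => hq z hz ?_
      simpa [hκ.ne'] using h
  rcases hτ.eq_or_lt with rfl | hτ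
  · simpa using hconst p hp
  by_cases hd : p.natDegree = 0
  · have h0 : polyDelta θ p = 0 := by
      rw [polyDelta_apply, natDegree_eq_zero_iff_degree_le_zero.1 hd |> eq_C_of_degree_le_zero]
      simp
    simpa [h0] using hconst p hp
  have hp' := hp.derivative hd
  -- With `p` nonconstant and `τ > 0`, this is the only case in which the result is the zero
  -- polynomial.
  by_cases hdeg : κ = 0 ∧ θ = 0 ∧ (Polynomial.derivative p).natDegree = 0
  · obtain ⟨rfl, rfl, h⟩ := hdeg
    left
    rw [polyDelta_apply,
      eq_C_of_degree_le_zero (natDegree_eq_zero_iff_degree_le_zero.1 h)]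
    simp
  refine Or.inr fun z hz h => ?_
  have hz0 : z ≠ 0 := by
    rintro rfl
    simp at hz
  have e0 := hp z hz
  have e1 := hp' z hz
  set A := aeval (z ^ 2) p
  set A' := aeval (z ^ 2) (Polynomial.derivative p) with hA'
  set A'' := aeval (z ^ 2) (Polynomial.derivative (Polynomial.derivative p)) with hA''
  have hsum : (κ : ℂ) * (z * (A' / A))⁻¹ + τ * (θ * z⁻¹ + z * (A'' / A')) = 0 := by
    have h' : (κ : ℂ) * A + τ * (θ * A' + z ^ 2 * A'') = 0 := by
      simpa [polyDelta_apply, A, hA', hA'', mul_add] using h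
    have : (κ : ℂ) * (z * (A' / A))⁻¹ + τ * (θ * z⁻¹ + z * (A'' / A')) =
        (κ * A + τ * (θ * A' + z ^ 2 * A'')) / (z * A') := by
      field_simp
    rw [this, h', zero_div]
  have r1 : 0 < (z * (A' / A))⁻¹.re := by
    have := hp.re_logDeriv_pos hz hd
    rw [Complex.inv_re]
    refine div_pos this (Complex.normSq_pos.2 ?_)
    simp [hz0, e0, e1, A]
  have r2 : 0 < (z⁻¹).re := by
    rw [Complex.inv_re]
    exact div_pos hz (Complex.normSq_pos.2 hz0)
  have r3 : 0 ≤ (z * (A'' / A')).re := hp'.re_logDeriv_nonneg hz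
  have hre := congrArg Complex.re hsum
  rw [Complex.add_re, Complex.re_ofReal_mul, Complex.re_ofReal_mul, Complex.add_re,
    Complex.re_ofReal_mul, Complex.zero_re] at hre
  have s1 : 0 ≤ κ * (z * (A' / A))⁻¹.re := mul_nonneg hκ r1.le
  have s2 : 0 ≤ θ * (z⁻¹).re := mul_nonneg hθ r2.le
  -- At a zero every nonnegative real part must vanish, which forces exactly the excluded degenerate
  -- case.
  have s3 : τ * (θ * (z⁻¹).re + (z * (A'' / A')).re) = 0 :=
    le_antisymm (by linarith) (mul_nonneg hτ.le (by linarith))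
  have s4 : θ * (z⁻¹).re + (z * (A'' / A')).re = 0 := (mul_eq_zero.1 s3).resolve_left hτ.ne'
  have k0 : κ = 0 := (mul_eq_zero.1 (by linarith : κ * (z * (A' / A))⁻¹.re = 0)).resolve_right r1.ne'
  have t0 : θ = 0 := (mul_eq_zero.1 (by linarith : θ * (z⁻¹).re = 0)).resolve_right r2.ne'
  exact (hp'.re_logDeriv_pos hz fun hn => hdeg ⟨k0, t0, hn⟩).ne' (by
    change (z * (A'' / A')).re = 0
    linarith)

/-- Products of polynomials `κ + τ X` with `κ, τ ≥ 0`. -/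
noncomputable def affineProducts : Submonoid ℝ[X] :=
  Submonoid.closure {q | ∃ κ τ : ℝ, 0 ≤ κ ∧ 0 ≤ τ ∧ q = C κ + C τ * X}

theorem affine_mem_affineProducts {κ τ : ℝ} (hκ : 0 ≤ κ) (hτ : 0 ≤ τ) :
    C κ + C τ * X ∈ affineProducts :=
  Submonoid.subset_closure ⟨κ, τ, hκ, hτ, rfl⟩

/-- Evaluation at an operator turns products into compositions, so the affine factors act one at a
time. -/
theorem aeval_polyDelta_of_mem_affineProducts {θ : ℝ} (hθ : 0 ≤ θ) {q : ℝ[X]}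
    (hq : q ∈ affineProducts) : ∀ p : ℝ[X], (p = 0 ∨ NonposRooted p) →
      (aeval (polyDelta θ) q p = 0 ∨ NonposRooted (aeval (polyDelta θ) q p)) := by
  induction hq using Submonoid.closure_induction with
  | mem q hq =>
    obtain ⟨κ, τ, hκ, hτ, rfl⟩ := hq
    rintro p (rfl | hp)
    · simp
    · have := hp.affine_polyDelta hθ hκ hτ
      simpa [Algebra.algebraMap_eq_smul_one] using this
  | one => simp
  | mul q r _ _ ihq ihr =>
    intro p hp
    rw [map_mul, Module.End.mul_apply]
    exact ihq _ (ihr p hp)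

theorem zero_or_nonposRooted_of_mem_affineProducts {q : ℝ[X]} (hq : q ∈ affineProducts) :
    q = 0 ∨ NonposRooted q := by
  induction hq using Submonoid.closure_induction with
  | mem q hq =>
    obtain ⟨κ, τ, hκ, hτ, rfl⟩ := hq
    by_cases h : κ = 0 ∧ τ = 0
    · simp [h.1, h.2]
    refine Or.inr fun z hz hzero => h ?_
    have hz0 : z ≠ 0 := by
      rintro rfl
      simp at hz
    have h1 : (κ : ℂ) * z⁻¹ + τ * z = 0 := by
      have : (κ : ℂ) + τ * z ^ 2 = 0 := by simpa using hzero
      have h2 : (κ : ℂ) * z⁻¹ + τ * z = (κ + τ * z ^ 2) / z := by field_simp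
      rw [h2, this, zero_div]
    have r2 : 0 < (z⁻¹).re := by
      rw [Complex.inv_re]
      exact div_pos hz (Complex.normSq_pos.2 hz0)
    have hre := congrArg Complex.re h1
    rw [Complex.add_re, Complex.re_ofReal_mul, Complex.re_ofReal_mul, Complex.zero_re] at hre
    have s1 := mul_nonneg hκ r2.le
    have s2 := mul_nonneg hτ hz.le
    exact ⟨(mul_eq_zero.1 (by linarith : κ * (z⁻¹).re = 0)).resolve_right r2.ne',
      (mul_eq_zero.1 (by linarith : τ * z.re = 0)).resolve_right hz.ne'⟩
  | one => exact Or.inr fun z _ => by simp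
  | mul q r _ _ ihq ihr =>
    rcases ihq with rfl | hq
    · simp
    rcases ihr with rfl | hr
    · simp
    refine Or.inr fun z hz => ?_
    rw [map_mul]
    exact mul_ne_zero (hq z hz) (hr z hz)

/-! ### Laguerre's theorem on limits of polynomials with nonpositive zeros -/

theorem List.prod_range_getD {M : Type*} [CommMonoid M] {α : Type*} (L : List α) (d : α)
    (f : α → M) : ∏ j ∈ Finset.range L.length, f (L.getD j d) = (L.map f).prod := by
  induction L with
  | nil => simp
  | cons a L ih =>
    rw [List.length_cons, Finset.prod_range_succ']
    simp only [List.getD_cons_succ, List.getD_cons_zero, List.map_cons, List.prod_cons]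
    rw [ih, mul_comm]

theorem List.antitone_getD_zero (L : List ℝ) (hL : L.Pairwise (· ≥ ·)) (hpos : ∀ x ∈ L, 0 ≤ x) :
    Antitone fun j => L.getD j 0 := by
  intro i j hij
  rcases hij.eq_or_lt with rfl | hij
  · exact le_rfl
  beta_reduce
  by_cases hj : j < L.length
  · have hi : i < L.length := hij.trans hj
    simpa [List.getD_eq_getElem, hi, hj] using List.pairwise_iff_getElem.1 hL i j hi hj hij
  · rw [List.getD_eq_default _ _ (not_lt.1 hj)]
    by_cases hi : i < L.length
    · rw [List.getD_eq_getElem _ _ hi]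
      exact hpos _ (List.getElem_mem hi)
    · rw [List.getD_eq_default _ _ (not_lt.1 hi)]

theorem NonposRooted.exists_factorization {p : ℝ[X]} (hp : NonposRooted p) (h0 : p.coeff 0 ≠ 0) :
    ∃ (L : ℕ) (β : ℕ → ℝ), Antitone β ∧ (∀ j, 0 ≤ β j) ∧ (∀ j, L ≤ j → β j = 0) ∧
      ∀ z : ℂ, aeval z p = p.coeff 0 * ∏ j ∈ Finset.range L, (1 + (β j : ℂ) * z) := by
  set q : ℂ[X] := p.map (algebraMap ℝ ℂ) with hq
  have hsplit : q.Splits := IsAlgClosed.splits q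
  have hroot : ∀ w ∈ q.roots, w ≠ 0 ∧ 0 ≤ -1 / w.re ∧ ((-1 / w.re : ℝ) : ℂ) = -1 / w := by
    intro w hw
    have hx' : aeval w p = 0 := by
      have := (mem_roots'.1 hw).2
      rwa [hq, IsRoot, eval_map_algebraMap] at this
    obtain ⟨t, rfl⟩ := hp.exists_root_eq hx'
    have hre : (-(t : ℂ) ^ 2).re = -t ^ 2 := by
      rw [← Complex.ofReal_pow, ← Complex.ofReal_neg, Complex.ofReal_re]
    refine ⟨fun h => h0 ?_, ?_, ?_⟩
    · rw [h] at hx'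
      rw [coeff_zero_eq_aeval_zero]
      have := hx'
      rw [← map_zero (algebraMap ℝ ℂ), aeval_algebraMap_apply] at this
      simpa using this
    · rw [hre, neg_div_neg_eq]
      positivity
    · rw [hre]
      push_cast
      rfl
  set s : Multiset ℝ := q.roots.map fun w => -1 / w.re with hs
  -- Decreasing order, followed by padding with the default value `0`, makes the sequence antitone
  -- on all of `ℕ`.
  set L : List ℝ := s.sort (· ≥ ·) with hL
  have hpos : ∀ x ∈ L, 0 ≤ x := by
    intro x hx
    rw [hL, Multiset.mem_sort, hs] at hx
    obtain ⟨w, hw, rfl⟩ := Multiset.mem_map.1 hx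
    exact (hroot w hw).2.1
  refine ⟨L.length, fun j => L.getD j 0,
    List.antitone_getD_zero L (Multiset.pairwise_sort _ _) hpos, ?_, ?_, ?_⟩
  · intro j
    beta_reduce
    by_cases hj : j < L.length
    · rw [List.getD_eq_getElem _ _ hj]
      exact hpos _ (List.getElem_mem hj)
    · rw [List.getD_eq_default _ _ (not_lt.1 hj)]
  · intro j hj
    exact List.getD_eq_default _ _ hj
  · have hev : ∀ z : ℂ, aeval z p = q.leadingCoeff * (q.roots.map fun w => z - w).prod := by
      intro z
      rw [← eval_map_algebraMap, ← hq, hsplit.eval_eq_prod_roots]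
    have hc : (p.coeff 0 : ℂ) = q.leadingCoeff * (q.roots.map fun w => -w).prod := by
      have h := hev 0
      rw [← map_zero (algebraMap ℝ ℂ), aeval_algebraMap_apply, ← coeff_zero_eq_aeval_zero] at h
      simpa using h
    intro z
    rw [List.prod_range_getD L 0 fun x : ℝ => 1 + (x : ℂ) * z, ← Multiset.prod_coe,
      ← Multiset.map_coe, hL, Multiset.sort_eq, hs, Multiset.map_map, hc, mul_assoc,
      ← Multiset.prod_map_mul, hev]
    congr 2
    refine Multiset.map_congr rfl fun w hw => ?_
    obtain ⟨hw0, -, hw2⟩ := hroot w hw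
    simp only [Function.comp_apply]
    rw [hw2]
    field_simp
    ring

/-- A uniform bound on the sums gives only `O(1/j)` decay: not summable, but square summable, which
suffices below. -/
theorem antitone_le_tsum_div {β : ℕ → ℝ} (hβ : Antitone β) {S : ℝ}
    (hS : ∀ n, ∑ j ∈ Finset.range n, β j ≤ S) (j : ℕ) : β j ≤ S / (j + 1) := by
  rw [le_div_iff₀ (by positivity)]
  have : ((Finset.range (j + 1)).card : ℕ) • β j ≤ ∑ i ∈ Finset.range (j + 1), β i :=
    Finset.card_nsmul_le_sum _ _ _ fun i hi => hβ (by simpa [Nat.lt_succ_iff] using hi)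
  rw [Finset.card_range, nsmul_eq_mul] at this
  push_cast at this
  linarith [hS (j + 1)]

theorem norm_one_add_mul_exp_neg_sub_one_le (w : ℂ) :
    ‖(1 + w) * Complex.exp (-w) - 1‖ ≤ ‖w‖ ^ 2 * Real.exp (2 * ‖w‖) := by
  have h1 : (1 + w) * Complex.exp (-w) - 1 = -((Complex.exp w - (1 + w)) * Complex.exp (-w)) := by
    rw [sub_mul, ← Complex.exp_add, add_neg_cancel, Complex.exp_zero]
    ring
  have h2 : ‖Complex.exp w - (1 + w)‖ ≤ ‖w‖ ^ 2 * Real.exp ‖w‖ := by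
    simpa [Finset.sum_range_succ] using Complex.norm_exp_sub_sum_le_norm_mul_exp w 2
  have h3 : ‖Complex.exp (-w)‖ ≤ Real.exp ‖w‖ := by
    simpa using Complex.norm_exp_le_exp_norm (-w)
  rw [h1, norm_neg, norm_mul, two_mul, Real.exp_add, ← mul_assoc]
  exact mul_le_mul h2 h3 (norm_nonneg _) (by positivity)

theorem summable_norm_ofReal_mul {β : ℕ → ℝ} (hs : Summable β) (h0 : ∀ j, 0 ≤ β j) (z : ℂ) :
    Summable fun j => ‖(β j : ℂ) * z‖ := by
  refine (hs.mul_right ‖z‖).congr fun j => ?_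
  rw [norm_mul, Complex.norm_real, Real.norm_of_nonneg (h0 j)]

theorem tprod_one_add_mul_exp {β : ℕ → ℝ} (hs : Summable β) (h0 : ∀ j, 0 ≤ β j) (z : ℂ) :
    ∏' j, (1 + (β j : ℂ) * z) = Complex.exp ((∑' j, β j : ℝ) * z) *
      ∏' j, (1 + ((1 + (β j : ℂ) * z) * Complex.exp (-((β j : ℂ) * z)) - 1)) := by
  have h1 : Multipliable fun j => 1 + (β j : ℂ) * z :=
    multipliable_one_add_of_summable (summable_norm_ofReal_mul hs h0 z)
  have h2 : HasSum (fun j => -((β j : ℂ) * z)) (-((∑' j, β j : ℝ) * z)) :=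
    ((Complex.hasSum_ofReal.2 hs.hasSum).mul_right z).neg
  have h3 : HasProd (fun j => Complex.exp (-((β j : ℂ) * z)))
      (Complex.exp (-((∑' j, β j : ℝ) * z))) := h2.cexp
  have h4 := (h1.hasProd.mul h3).tprod_eq
  simp only [add_sub_cancel]
  rw [h4, mul_comm, mul_assoc, ← Complex.exp_add, neg_add_cancel, Complex.exp_zero, mul_one]

/-- Zeros may escape to infinity while their reciprocals keep a positive total mass; the lost mass
becomes the exponent `α`. -/
theorem exists_exp_mul_tprod_of_tendsto {B : ℕ → ℕ → ℝ} {S : ℝ} (hanti : ∀ N, Antitone (B N))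
    (h0 : ∀ N j, 0 ≤ B N j) (hsum : ∀ N, Summable (B N)) (hS : ∀ N, ∑' j, B N j ≤ S)
    {E : ℂ → ℂ} (hE : ∀ z, Tendsto (fun N => ∏' j, (1 + (B N j : ℂ) * z)) atTop (𝓝 (E z))) :
    ∃ (α : ℝ) (β : ℕ → ℝ), 0 ≤ α ∧ Antitone β ∧ (∀ j, 0 ≤ β j) ∧ Summable β ∧
      ∀ z, E z = Complex.exp (α * z) * ∏' j, (1 + (β j : ℂ) * z) := by
  have hpart : ∀ N n, ∑ j ∈ Finset.range n, B N j ≤ ∑' j, B N j := fun N n =>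
    (hsum N).sum_le_tsum _ fun j _ => h0 N j
  have hdiv : ∀ N j, B N j ≤ S / (j + 1) := fun N j =>
    antitone_le_tsum_div (hanti N) (fun n => (hpart N n).trans (hS N)) j
  have hBS : ∀ N j, B N j ≤ S := fun N j =>
    ((hsum N).le_tsum j fun i _ => h0 N i).trans (hS N)
  have hS0 : 0 ≤ S := (h0 0 0).trans (hBS 0 0)
  -- Tychonoff: one subsequence makes every `B N j` converge together with the total sums.
  have hcomp : IsCompact ((Set.univ.pi fun _ : ℕ => Set.Icc (0 : ℝ) S) ×ˢ Set.Icc (0 : ℝ) S) :=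
    (isCompact_univ_pi fun _ => isCompact_Icc).prod isCompact_Icc
  obtain ⟨⟨β, s⟩, -, ψ, hψ, hlim⟩ := hcomp.tendsto_subseq
    (x := fun N => (B N, ∑' j, B N j)) fun N =>
      ⟨fun j _ => ⟨h0 N j, hBS N j⟩, tsum_nonneg (h0 N), hS N⟩
  have hβ : ∀ j, Tendsto (fun N => B (ψ N) j) atTop (𝓝 (β j)) := fun j =>
    (tendsto_pi_nhds.1 ((continuous_fst.tendsto _).comp hlim)) j
  have hs : Tendsto (fun N => ∑' j, B (ψ N) j) atTop (𝓝 s) :=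
    (continuous_snd.tendsto _).comp hlim
  have hβ0 : ∀ j, 0 ≤ β j := fun j => ge_of_tendsto' (hβ j) fun N => h0 _ j
  have hβanti : Antitone β := fun i j hij =>
    le_of_tendsto_of_tendsto' (hβ j) (hβ i) fun N => hanti _ hij
  have hβs : ∀ n, ∑ j ∈ Finset.range n, β j ≤ s := fun n =>
    le_of_tendsto_of_tendsto' (tendsto_finsetSum _ fun j _ => hβ j) hs fun N => hpart _ n
  have hβsum : Summable β := summable_of_sum_range_le hβ0 hβs
  have hα : ∑' j, β j ≤ s := hβsum.tsum_le_of_sum_range_le hβs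
  -- The limit `s` of the sums is at least the sum of the limits, hence `α ≥ 0`.
  refine ⟨s - ∑' j, β j, β, sub_nonneg.2 hα, hβanti, hβ0, hβsum, fun z => ?_⟩
  have hprod : Tendsto (fun N => ∏' j, (1 + ((1 + (B (ψ N) j : ℂ) * z) *
      Complex.exp (-((B (ψ N) j : ℂ) * z)) - 1))) atTop
      (𝓝 (∏' j, (1 + ((1 + (β j : ℂ) * z) * Complex.exp (-((β j : ℂ) * z)) - 1)))) := by
    refine tendsto_tprod_one_add_of_dominated_convergence
      (bound := fun j : ℕ => (S * ‖z‖) ^ 2 * Real.exp (2 * (S * ‖z‖)) * (1 / ((j : ℝ) + 1) ^ 2))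
      ?_ ?_ ?_
    · refine Summable.mul_left _ ?_
      exact_mod_cast (summable_nat_add_iff 1).2 (Real.summable_one_div_nat_pow.2 one_lt_two)
    · intro j
      have hc : Continuous fun x : ℝ => (1 + (x : ℂ) * z) * Complex.exp (-((x : ℂ) * z)) - 1 := by
        fun_prop
      exact (hc.tendsto _).comp (hβ j)
    · refine Eventually.of_forall fun N j => ?_
      have hn : ‖(B (ψ N) j : ℂ) * z‖ = B (ψ N) j * ‖z‖ := by
        rw [norm_mul, Complex.norm_real, Real.norm_of_nonneg (h0 _ j)]
      refine (norm_one_add_mul_exp_neg_sub_one_le _).trans ?_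
      rw [hn]
      have e1 : (B (ψ N) j * ‖z‖) ^ 2 ≤ (S * ‖z‖) ^ 2 * (1 / ((j : ℝ) + 1) ^ 2) := by
        have : (S * ‖z‖) ^ 2 * (1 / ((j : ℝ) + 1) ^ 2) = (S / (j + 1) * ‖z‖) ^ 2 := by
          field_simp
        rw [this]
        have := h0 (ψ N) j
        have := hdiv (ψ N) j
        gcongr
      have e2 : Real.exp (2 * (B (ψ N) j * ‖z‖)) ≤ Real.exp (2 * (S * ‖z‖)) := by
        have := hBS (ψ N) j
        gcongr
      calc _ ≤ (S * ‖z‖) ^ 2 * (1 / ((j : ℝ) + 1) ^ 2) * Real.exp (2 * (S * ‖z‖)) := by gcongr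
        _ = _ := by ring
  have hexp : Tendsto (fun N => Complex.exp ((∑' j, B (ψ N) j : ℝ) * z)) atTop
      (𝓝 (Complex.exp (s * z))) := by
    have hc : Continuous fun x : ℝ => Complex.exp ((x : ℂ) * z) := by fun_prop
    exact (hc.tendsto _).comp hs
  have hlimE := hexp.mul hprod
  have hE' := (hE z).comp hψ.tendsto_atTop
  have heq : E z = _ := tendsto_nhds_unique hE' (hlimE.congr fun N =>
    (tprod_one_add_mul_exp (hsum (ψ N)) (h0 (ψ N)) z).symm)
  rw [heq, tprod_one_add_mul_exp hβsum hβ0, ← mul_assoc, ← Complex.exp_add]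
  congr 2
  push_cast
  ring

/-- The bound on the sum comes from `1 + ∑ β_j ≤ ∏ (1 + β_j) = p(1)/p(0)`; it is uniform along a
convergent sequence. -/
theorem NonposRooted.exists_tprod {p : ℝ[X]} (hp : NonposRooted p) (h0 : p.coeff 0 ≠ 0) :
    ∃ β : ℕ → ℝ, Antitone β ∧ (∀ j, 0 ≤ β j) ∧ Summable β ∧
      ∑' j, β j ≤ p.eval 1 / p.coeff 0 ∧
      ∀ z : ℂ, aeval z p = p.coeff 0 * ∏' j, (1 + (β j : ℂ) * z) := by
  obtain ⟨L, β, hanti, hβ0, hβ, hz⟩ := hp.exists_factorization h0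
  have hfin : ∀ j ∉ Finset.range L, β j = 0 := fun j hj => hβ j (by simpa using hj)
  refine ⟨β, hanti, hβ0, summable_of_ne_finset_zero hfin, ?_, fun z => ?_⟩
  · rw [tsum_eq_sum hfin]
    have h1 : p.eval 1 / p.coeff 0 = ∏ j ∈ Finset.range L, (1 + β j) := by
      have h := hz 1
      rw [← map_one (algebraMap ℝ ℂ), aeval_algebraMap_apply] at h
      have : ((p.eval 1 : ℝ) : ℂ) = ((p.coeff 0 * ∏ j ∈ Finset.range L, (1 + β j) : ℝ) : ℂ) := by
        simpa using h
      rw [Complex.ofReal_inj.1 this, mul_div_cancel_left₀ _ h0]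
    rw [h1]
    have h2 : ∀ s : Finset ℕ, 1 + ∑ j ∈ s, β j ≤ ∏ j ∈ s, (1 + β j) := by
      intro s
      induction s using Finset.induction_on with
      | empty => simp
      | insert a s ha ih =>
        rw [Finset.sum_insert ha, Finset.prod_insert ha]
        have := hβ0 a
        have : 0 ≤ ∑ j ∈ s, β j := Finset.sum_nonneg fun j _ => hβ0 j
        nlinarith [mul_nonneg (hβ0 a) this]
    linarith [h2 (Finset.range L)]
  · rw [hz, tprod_eq_prod fun j hj => by simp [hfin j hj]]

theorem aeval_eq_tsum {p : ℝ[X]} (z : ℂ) : aeval z p = ∑' n, (p.coeff n : ℂ) * z ^ n := by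
  rw [aeval_eq_sum_range, tsum_eq_sum (s := Finset.range (p.natDegree + 1))]
  · simp
  · intro n hn
    rw [coeff_eq_zero_of_natDegree_lt (by simpa [Nat.lt_succ_iff] using hn)]
    simp

theorem tendsto_aeval_of_coeff {P : ℕ → ℝ[X]} {c : ℕ → ℝ} (h0 : ∀ N n, 0 ≤ (P N).coeff n)
    (hle : ∀ N n, (P N).coeff n ≤ c n)
    (hlim : ∀ n, Tendsto (fun N => (P N).coeff n) atTop (𝓝 (c n)))
    {z : ℂ} (hc : Summable fun n => c n * ‖z‖ ^ n) :
    Tendsto (fun N => aeval z (P N)) atTop (𝓝 (∑' n, (c n : ℂ) * z ^ n)) := by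
  simp only [aeval_eq_tsum]
  refine tendsto_tsum_of_dominated_convergence hc (fun n => ?_) (Eventually.of_forall fun N n => ?_)
  · exact ((Complex.continuous_ofReal.tendsto _).comp (hlim n)).mul_const _
  · rw [norm_mul, norm_pow, Complex.norm_real, Real.norm_of_nonneg (h0 N n)]
    exact mul_le_mul_of_nonneg_right (hle N n) (by positivity)

/-- Laguerre's theorem: a limit of polynomials with only nonpositive zeros is a Laguerre entire
function, here under domination of the coefficients. -/
theorem mem_laguerreEntire_of_tendsto {P : ℕ → ℝ[X]} (hP : ∀ N, P N = 0 ∨ NonposRooted (P N))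
    {c : ℕ → ℝ} (h0 : ∀ N n, 0 ≤ (P N).coeff n) (hle : ∀ N n, (P N).coeff n ≤ c n)
    (hlim : ∀ n, Tendsto (fun N => (P N).coeff n) atTop (𝓝 (c n)))
    (hc : ∀ r : ℝ, 0 ≤ r → Summable fun n => c n * r ^ n)
    {g : ℂ → ℂ} (hg : Differentiable ℂ g) {K : ℂ} (hgc : ∀ z, g z = K * ∑' n, (c n : ℂ) * z ^ n) :
    g ∈ laguerreEntire := by
  refine ⟨hg, ?_⟩
  by_cases hzero : ∀ n, c n = 0
  · exact ⟨0, 0, 0, 0, le_rfl, antitone_const, fun _ => le_rfl, summable_zero, fun z => by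
      simp [hgc, hzero]⟩
  push Not at hzero
  classical
  set l := Nat.find hzero
  have hcl : c l ≠ 0 := Nat.find_spec hzero
  have hlt : ∀ d < l, c d = 0 := fun d hd => not_not.1 (Nat.find_min hzero hd)
  have hc0 : ∀ n, 0 ≤ c n := fun n => (h0 0 n).trans (hle 0 n)
  have hclpos : 0 < c l := (hc0 l).lt_of_ne hcl.symm
  -- After `X ^ l` is divided out, the constant terms stay above `c l / 2`, so the ratios
  -- `p(1)/p(0)` remain bounded.
  obtain ⟨N₀, hN₀⟩ := eventually_atTop.1 ((hlim l).eventually (lt_mem_nhds (half_lt_self hclpos)))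
  -- Coefficients below degree `l` lie between `0` and `c d = 0`.
  have hdvd : ∀ N, ∃ q : ℝ[X], P N = X ^ l * q := fun N =>
    X_pow_dvd_iff.2 fun d hd => le_antisymm ((hle N d).trans (hlt d hd).le) (h0 N d)
  choose H hH using hdvd
  have hcoeff : ∀ N n, (H N).coeff n = (P N).coeff (n + l) := fun N n => by
    rw [hH N, coeff_X_pow_mul]
  have hpos : ∀ N, c l / 2 < (H (N + N₀)).coeff 0 := fun N => by
    rw [hcoeff, zero_add]
    exact hN₀ _ (Nat.le_add_left _ _)
  have hHroot : ∀ N, NonposRooted (H (N + N₀)) := by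
    intro N z hz h
    have hne : P (N + N₀) ≠ 0 := by
      intro h0
      have := hpos N
      rw [hcoeff, h0, coeff_zero] at this
      linarith
    refine (hP _).resolve_left hne z hz ?_
    rw [hH, map_mul, h, mul_zero]
  have hHne : ∀ N, (H (N + N₀)).coeff 0 ≠ 0 := fun N => by
    have := hpos N
    intro h
    linarith
  choose B hanti hB0 hBs hBle hBz using fun N => (hHroot N).exists_tprod (hHne N)
  have hlim' : ∀ n, Tendsto (fun N => (H (N + N₀)).coeff n) atTop (𝓝 (c (n + l))) := fun n => by
    simp only [hcoeff]
    exact (hlim (n + l)).comp (tendsto_add_atTop_nat N₀)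
  have hle' : ∀ N n, (H (N + N₀)).coeff n ≤ c (n + l) := fun N n => by
    rw [hcoeff]
    exact hle _ _
  have h0' : ∀ N n, 0 ≤ (H (N + N₀)).coeff n := fun N n => by
    rw [hcoeff]
    exact h0 _ _
  have hc' : ∀ r : ℝ, 0 ≤ r → Summable fun n => c (n + l) * r ^ n := by
    intro r hr
    rcases hr.eq_or_lt with rfl | hr
    · refine summable_of_ne_finset_zero (s := {0}) fun n hn => ?_
      rw [zero_pow (by simpa using hn), mul_zero]
    · refine (((summable_nat_add_iff l).2 (hc r hr.le)).mul_right (r ^ l)⁻¹).congr fun n => ?_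
      rw [pow_add]
      field_simp
  have hS : ∀ N, ∑' j, B N j ≤ (∑' n, c (n + l)) / (c l / 2) := by
    intro N
    refine (hBle N).trans ?_
    have h1 : (H (N + N₀)).eval 1 ≤ ∑' n, c (n + l) := by
      rw [eval_eq_sum_range]
      simp only [one_pow, mul_one]
      refine (Finset.sum_le_sum fun n _ => hle' N n).trans ?_
      exact Summable.sum_le_tsum _ (fun n _ => hc0 _) (by simpa using hc' 1 zero_le_one)
    have h2 : 0 ≤ ∑' n, c (n + l) := tsum_nonneg fun n => hc0 _
    have := hpos N
    gcongr
  have hE : ∀ z, Tendsto (fun N => ∏' j, (1 + (B N j : ℂ) * z)) atTop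
      (𝓝 ((∑' n, (c (n + l) : ℂ) * z ^ n) / c l)) := by
    intro z
    have h1 := tendsto_aeval_of_coeff h0' hle' hlim' (hc' ‖z‖ (norm_nonneg z))
    have h2 : Tendsto (fun N => (((H (N + N₀)).coeff 0 : ℝ) : ℂ)) atTop (𝓝 (c l : ℂ)) := by
      have := (Complex.continuous_ofReal.tendsto _).comp (hlim' 0)
      rwa [zero_add] at this
    refine (h1.div h2 (by exact_mod_cast hcl)).congr fun N => ?_
    rw [Pi.div_apply, hBz, mul_div_cancel_left₀]
    exact_mod_cast hHne N
  obtain ⟨α, β, hα, hβ, hβ0, hβs, hEz⟩ := exists_exp_mul_tprod_of_tendsto hanti hB0 hBs hS hE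
  refine ⟨K * c l, l, α, β, hα, hβ, hβ0, hβs, fun z => ?_⟩
  have hshift : ∑' n, (c n : ℂ) * z ^ n = z ^ l * ∑' n, (c (n + l) : ℂ) * z ^ n := by
    have hsm : Summable fun n => (c n : ℂ) * z ^ n := by
      refine .of_norm ((hc ‖z‖ (norm_nonneg z)).congr fun n => ?_)
      rw [norm_mul, norm_pow, Complex.norm_real, Real.norm_of_nonneg (hc0 n)]
    rw [← hsm.sum_add_tsum_nat_add l, Finset.sum_eq_zero, zero_add, ← tsum_mul_left]
    · refine tsum_congr fun n => ?_
      rw [pow_add]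
      ring
    · intro d hd
      rw [hlt d (Finset.mem_range.1 hd)]
      simp
  have hEz' := hEz z
  rw [div_eq_iff (by exact_mod_cast hcl)] at hEz'
  rw [hgc, hshift, hEz']
  ring

/-! ### Everywhere convergent power series -/

theorem hasFPowerSeriesOnBall_of_eq_tsum {a : ℕ → ℂ}
    (ha : ∀ r : ℝ, 0 ≤ r → Summable fun n => ‖a n‖ * r ^ n) {f : ℂ → ℂ}
    (hf : ∀ z, f z = ∑' n, a n * z ^ n) :
    HasFPowerSeriesOnBall f (FormalMultilinearSeries.ofScalars ℂ a) 0 ⊤ where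
  r_le := by
    refine le_of_eq (ENNReal.eq_top_of_forall_nnreal_le fun r => ?_).symm
    refine FormalMultilinearSeries.le_radius_of_summable _ ?_
    simpa only [FormalMultilinearSeries.ofScalars_norm] using ha r r.2
  r_pos := ENNReal.zero_lt_top
  hasSum := fun {z} _ => by
    simp only [FormalMultilinearSeries.ofScalars_apply_eq, smul_eq_mul, zero_add]
    rw [hf]
    refine (Summable.of_norm ?_).hasSum
    simpa only [norm_mul, norm_pow] using ha ‖z‖ (norm_nonneg z)

theorem differentiable_of_eq_tsum {a : ℕ → ℂ}
    (ha : ∀ r : ℝ, 0 ≤ r → Summable fun n => ‖a n‖ * r ^ n) {f : ℂ → ℂ}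
    (hf : ∀ z, f z = ∑' n, a n * z ^ n) : Differentiable ℂ f := fun z =>
  ((hasFPowerSeriesOnBall_of_eq_tsum ha hf).analyticAt_of_mem (by simp)).differentiableAt

theorem iteratedDeriv_of_eq_tsum {a : ℕ → ℂ}
    (ha : ∀ r : ℝ, 0 ≤ r → Summable fun n => ‖a n‖ * r ^ n) {f : ℂ → ℂ}
    (hf : ∀ z, f z = ∑' n, a n * z ^ n) (n : ℕ) : iteratedDeriv n f 0 = n.factorial * a n := by
  have h := (hasFPowerSeriesOnBall_of_eq_tsum ha hf).factorial_smul 1 n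
  rw [iteratedDeriv_eq_iteratedFDeriv]
  simpa [FormalMultilinearSeries.ofScalars_apply_eq] using h.symm

/-! ### Approximation of Laguerre entire functions from below -/

theorem coeff_mul_le_coeff_mul {p q r s : ℝ[X]} (hp : ∀ n, 0 ≤ p.coeff n)
    (hr : ∀ n, 0 ≤ r.coeff n) (hpq : ∀ n, p.coeff n ≤ q.coeff n)
    (hrs : ∀ n, r.coeff n ≤ s.coeff n) (n : ℕ) : (p * r).coeff n ≤ (q * s).coeff n := by
  rw [coeff_mul, coeff_mul]
  exact Finset.sum_le_sum fun i _ =>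
    mul_le_mul (hpq _) (hrs _) (hr _) ((hp _).trans (hpq _))

theorem coeff_mul_nonneg {p q : ℝ[X]} (hp : ∀ n, 0 ≤ p.coeff n) (hq : ∀ n, 0 ≤ q.coeff n)
    (n : ℕ) : 0 ≤ (p * q).coeff n := by
  rw [coeff_mul]
  exact Finset.sum_nonneg fun i _ => mul_nonneg (hp _) (hq _)

theorem coeff_nonneg_of_mem_affineProducts {q : ℝ[X]} (hq : q ∈ affineProducts) :
    ∀ n, 0 ≤ q.coeff n := by
  induction hq using Submonoid.closure_induction with
  | mem q hq =>
    obtain ⟨κ, τ, hκ, hτ, rfl⟩ := hq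
    intro n
    rw [coeff_add, coeff_C, coeff_C_mul, coeff_X]
    split_ifs <;> simp [hκ, hτ, add_nonneg]
  | one =>
    intro n
    rw [coeff_one]
    split_ifs <;> simp
  | mul q r _ _ ihq ihr => exact coeff_mul_nonneg ihq ihr

theorem coeff_pow_le_coeff_pow {p q : ℝ[X]} (hp : ∀ n, 0 ≤ p.coeff n)
    (hpq : ∀ n, p.coeff n ≤ q.coeff n) (k : ℕ) : ∀ n, (p ^ k).coeff n ≤ (q ^ k).coeff n := by
  have hpk : ∀ k n, 0 ≤ (p ^ k).coeff n := by
    intro k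
    induction k with
    | zero =>
      intro n
      rw [pow_zero, coeff_one]
      split_ifs <;> simp
    | succ k ih =>
      rw [pow_succ]
      exact coeff_mul_nonneg ih hp
  induction k with
  | zero => simp
  | succ k ih =>
    rw [pow_succ, pow_succ]
    exact coeff_mul_le_coeff_mul (hpk k) hp ih hpq

/-- Polynomials approximating `z ^ l * exp (α z) * ∏' j, (1 + β j * z)`. -/
noncomputable def laguerreApprox (l : ℕ) (α : ℝ) (β : ℕ → ℝ) (N : ℕ) : ℝ[X] :=
  X ^ l * (C 1 + C (α / 2 ^ N) * X) ^ (2 ^ N) * ∏ j ∈ Finset.range N, (C 1 + C (β j) * X)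

theorem laguerreApprox_mem {l : ℕ} {α : ℝ} {β : ℕ → ℝ} (hα : 0 ≤ α) (hβ : ∀ j, 0 ≤ β j) (N : ℕ) :
    laguerreApprox l α β N ∈ affineProducts := by
  have hX : (X : ℝ[X]) ∈ affineProducts := by
    simpa using affine_mem_affineProducts le_rfl zero_le_one
  exact mul_mem (mul_mem (pow_mem hX _)
    (pow_mem (affine_mem_affineProducts zero_le_one (by positivity)) _))
    (prod_mem fun j _ => affine_mem_affineProducts zero_le_one (hβ j))

/-- The exponents `2 ^ N` make monotonicity immediate: `(1 + x)² = 1 + 2x + x²` dominates `1 + 2x`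
coefficientwise. -/
theorem monotone_coeff_laguerreApprox {l : ℕ} {α : ℝ} {β : ℕ → ℝ} (hα : 0 ≤ α)
    (hβ : ∀ j, 0 ≤ β j) (n : ℕ) : Monotone fun N => (laguerreApprox l α β N).coeff n := by
  have haff : ∀ τ : ℝ, 0 ≤ τ → C 1 + C τ * X ∈ affineProducts := fun τ hτ =>
    affine_mem_affineProducts zero_le_one hτ
  have hX : (X : ℝ[X]) ∈ affineProducts := by
    simpa using affine_mem_affineProducts le_rfl zero_le_one
  refine monotone_nat_of_le_succ fun N => ?_
  have hτ : 0 ≤ α / 2 ^ (N + 1) := by positivity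
  have hpow : ∀ n, ((C 1 + C (α / 2 ^ N) * X) ^ (2 ^ N)).coeff n ≤
      ((C 1 + C (α / 2 ^ (N + 1)) * X) ^ (2 ^ (N + 1))).coeff n := by
    rw [pow_succ' (2 : ℝ) N, pow_succ' (2 : ℕ) N, pow_mul]
    refine coeff_pow_le_coeff_pow (coeff_nonneg_of_mem_affineProducts (haff _ (by positivity)))
      (fun n => ?_) _
    have h1 : (C 1 + C (α / (2 * 2 ^ N)) * X) ^ 2 =
        (C 1 + C (α / 2 ^ N) * X) + C ((α / (2 * 2 ^ N)) ^ 2) * X ^ 2 := by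
      have h2 : α / 2 ^ N = α / (2 * 2 ^ N) + α / (2 * 2 ^ N) := by field_simp; norm_num
      rw [h2]
      simp only [map_add, map_pow, map_one]
      ring
    rw [h1, coeff_add _ (C ((α / (2 * 2 ^ N)) ^ 2) * X ^ 2), le_add_iff_nonneg_right,
      coeff_C_mul, coeff_X_pow]
    positivity
  have hprod : ∀ n, (∏ j ∈ Finset.range N, (C 1 + C (β j) * X)).coeff n ≤
      (∏ j ∈ Finset.range (N + 1), (C 1 + C (β j) * X)).coeff n := by
    intro n
    have hm : ∏ j ∈ Finset.range N, (C 1 + C (β j) * X) ∈ affineProducts :=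
      prod_mem fun j _ => haff _ (hβ j)
    rw [Finset.prod_range_succ, map_one, mul_add, mul_one, coeff_add, le_add_iff_nonneg_right,
      ← map_one C]
    refine coeff_mul_nonneg (coeff_nonneg_of_mem_affineProducts hm) (fun n => ?_) n
    rw [coeff_C_mul, coeff_X]
    have := hβ N
    positivity
  refine coeff_mul_le_coeff_mul ?_ ?_ (coeff_mul_le_coeff_mul ?_ ?_ (fun _ => le_rfl) hpow) hprod n
  · exact coeff_nonneg_of_mem_affineProducts
      (mul_mem (pow_mem hX _) (pow_mem (haff _ (by positivity)) _))
  · exact coeff_nonneg_of_mem_affineProducts (prod_mem fun j _ => haff _ (hβ j))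
  · exact coeff_nonneg_of_mem_affineProducts (pow_mem hX _)
  · exact coeff_nonneg_of_mem_affineProducts (pow_mem (haff _ (by positivity)) _)

theorem tendsto_aeval_laguerreApprox {l : ℕ} {α : ℝ} {β : ℕ → ℝ}
    (hβ : ∀ j, 0 ≤ β j) (hs : Summable β) (z : ℂ) :
    Tendsto (fun N => aeval z (laguerreApprox l α β N)) atTop
      (𝓝 (z ^ l * Complex.exp (α * z) * ∏' j, (1 + (β j : ℂ) * z))) := by
  have h1 : Tendsto (fun N : ℕ => (1 + (α * z) / ((2 ^ N : ℕ) : ℂ)) ^ (2 ^ N)) atTop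
      (𝓝 (Complex.exp (α * z))) :=
    (Complex.tendsto_one_add_div_pow_exp (α * z)).comp
      (tendsto_pow_atTop_atTop_of_one_lt one_lt_two)
  have h2 := (multipliable_one_add_of_summable
    (summable_norm_ofReal_mul hs hβ z)).hasProd.tendsto_prod_nat
  refine ((h1.const_mul (z ^ l)).mul h2).congr fun N => ?_
  simp only [laguerreApprox, map_mul, map_pow, aeval_X, map_add, map_prod, aeval_C, map_one]
  simp only [Complex.coe_algebraMap]
  push_cast
  congr 3
  ring

/-- Approximation of a Laguerre entire function by polynomials with nonpositive zeros, with
coefficients dominated by those of the limit. -/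
theorem exists_affineProducts_approx {f : ℂ → ℂ} (hf : f ∈ laguerreEntire) :
    ∃ (K : ℂ) (c : ℕ → ℝ) (P : ℕ → ℝ[X]), (∀ N, P N ∈ affineProducts) ∧
      (∀ N n, (P N).coeff n ≤ c n) ∧ (∀ n, Tendsto (fun N => (P N).coeff n) atTop (𝓝 (c n))) ∧
      ∀ n, iteratedDeriv n f 0 = n.factorial * (K * c n) := by
  obtain ⟨-, K, l, α, β, hα, -, hβ, hs, hfz⟩ := hf
  set P := laguerreApprox l α β
  have hP : ∀ N, P N ∈ affineProducts := laguerreApprox_mem hα hβ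
  have hP0 : ∀ N n, 0 ≤ (P N).coeff n := fun N => coeff_nonneg_of_mem_affineProducts (hP N)
  have hmono := monotone_coeff_laguerreApprox (l := l) hα hβ
  have hlim := tendsto_aeval_laguerreApprox (l := l) (α := α) hβ hs
  have hbdd : ∀ r : ℝ, 0 ≤ r → ∃ M, ∀ N, (P N).eval r ≤ M := by
    intro r hr
    obtain ⟨M, hM⟩ := (hlim r).norm.bddAbove_range
    refine ⟨M, fun N => (le_abs_self _).trans ?_⟩
    have h := hM ⟨N, rfl⟩
    have h2 : aeval (r : ℂ) (P N) = (((P N).eval r : ℝ) : ℂ) := by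
      simpa using aeval_algebraMap_apply ℂ r (P N)
    change ‖aeval (r : ℂ) (P N)‖ ≤ M at h
    rwa [h2, Complex.norm_real] at h
  have hpartial : ∀ (N : ℕ) (s : Finset ℕ) (r : ℝ), 0 ≤ r →
      ∑ n ∈ s, (P N).coeff n * r ^ n ≤ (P N).eval r := by
    intro N s r hr
    rw [eval_eq_sum_range]
    calc ∑ n ∈ s, (P N).coeff n * r ^ n
        ≤ ∑ n ∈ s ∪ Finset.range ((P N).natDegree + 1), (P N).coeff n * r ^ n :=
          Finset.sum_le_sum_of_subset_of_nonneg Finset.subset_union_left fun n _ _ =>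
            mul_nonneg (hP0 N n) (by positivity)
      _ = _ := by
          refine (Finset.sum_subset Finset.subset_union_right fun n _ hn => ?_).symm
          rw [coeff_eq_zero_of_natDegree_lt (by simpa [Nat.lt_succ_iff] using hn), zero_mul]
  have hcoeffbdd : ∀ n, BddAbove (Set.range fun N => (P N).coeff n) := by
    intro n
    obtain ⟨M, hM⟩ := hbdd 1 zero_le_one
    refine ⟨M, ?_⟩
    rintro _ ⟨N, rfl⟩
    have := hpartial N {n} 1 zero_le_one
    simp only [Finset.sum_singleton, one_pow, mul_one] at this
    exact this.trans (hM N)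
  -- Increasing coefficients, bounded by the values at `1`, converge to their supremum, which also
  -- dominates them.
  set c : ℕ → ℝ := fun n => ⨆ N, (P N).coeff n
  have hc : ∀ n, Tendsto (fun N => (P N).coeff n) atTop (𝓝 (c n)) := fun n =>
    tendsto_atTop_ciSup (hmono n) (hcoeffbdd n)
  have hle : ∀ N n, (P N).coeff n ≤ c n := fun N n => le_ciSup (hcoeffbdd n) N
  have hc0 : ∀ n, 0 ≤ c n := fun n => (hP0 0 n).trans (hle 0 n)
  have hsum : ∀ r : ℝ, 0 ≤ r → Summable fun n => c n * r ^ n := by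
    intro r hr
    obtain ⟨M, hM⟩ := hbdd r hr
    refine summable_of_sum_le (c := M) (fun n => mul_nonneg (hc0 n) (by positivity)) fun s => ?_
    exact le_of_tendsto' (tendsto_finsetSum s fun n _ => (hc n).mul_const (r ^ n)) fun N =>
      (hpartial N s r hr).trans (hM N)
  have hfc : ∀ z, f z = ∑' n, (K * c n) * z ^ n := by
    intro z
    have h1 := tendsto_nhds_unique (hlim z)
      (tendsto_aeval_of_coeff hP0 hle hc (hsum ‖z‖ (norm_nonneg z)))
    simp only [mul_assoc K]
    rw [hfz, tsum_mul_left, ← h1]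
    ring
  refine ⟨K, c, P, hP, hle, hc, iteratedDeriv_of_eq_tsum (fun r hr => ?_) hfc⟩
  refine ((hsum r hr).mul_left ‖K‖).congr fun n => ?_
  rw [norm_mul, Complex.norm_real, Real.norm_of_nonneg (hc0 n), mul_assoc]

/-! ### Action of `Δ_θ` on monomials -/

/-- The number `d` with `Δ_θ ^ k z ^ (n + k) = d z ^ n`. -/
noncomputable def deltaCoeff (θ : ℝ) (n k : ℕ) : ℝ :=
  ∏ i ∈ Finset.range k, (((n + i + 1 : ℕ) : ℝ) * (θ + (n + i : ℕ)))

theorem deltaCoeff_succ (θ : ℝ) (n k : ℕ) :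
    deltaCoeff θ n (k + 1) = deltaCoeff θ n k * (((n + k + 1 : ℕ) : ℝ) * (θ + (n + k : ℕ))) :=
  Finset.prod_range_succ _ _

theorem deltaCoeff_nonneg {θ : ℝ} (hθ : 0 ≤ θ) (n k : ℕ) : 0 ≤ deltaCoeff θ n k :=
  Finset.prod_nonneg fun i _ => by positivity

theorem coeff_polyDelta (θ : ℝ) (p : ℝ[X]) (m : ℕ) :
    (polyDelta θ p).coeff m = ((m + 1 : ℕ) : ℝ) * (θ + m) * p.coeff (m + 1) := by
  rw [polyDelta_apply, coeff_add, coeff_C_mul, coeff_derivative]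
  cases m with
  | zero => simp [mul_comm]
  | succ m =>
    rw [coeff_X_mul, coeff_derivative, coeff_derivative]
    push_cast
    ring

theorem coeff_polyDelta_pow (θ : ℝ) (k : ℕ) (p : ℝ[X]) (n : ℕ) :
    ((polyDelta θ ^ k) p).coeff n = deltaCoeff θ n k * p.coeff (n + k) := by
  induction k generalizing p with
  | zero => simp [deltaCoeff]
  | succ k ih =>
    rw [pow_succ, Module.End.mul_apply, ih, coeff_polyDelta, deltaCoeff_succ, ← add_assoc]
    ring

theorem coeff_aeval_polyDelta (θ : ℝ) (q p : ℝ[X]) (n : ℕ) :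
    (aeval (polyDelta θ) q p).coeff n =
      ∑' k, q.coeff k * p.coeff (n + k) * deltaCoeff θ n k := by
  rw [aeval_eq_sum_range, LinearMap.sum_apply, finsetSum_coeff,
    tsum_eq_sum (s := Finset.range (q.natDegree + 1))]
  · refine Finset.sum_congr rfl fun k _ => ?_
    rw [LinearMap.smul_apply, coeff_smul, coeff_polyDelta_pow, smul_eq_mul]
    ring
  · intro k hk
    rw [coeff_eq_zero_of_natDegree_lt (by simpa [Nat.lt_succ_iff] using hk)]
    simp

theorem laguerreDelta_const (θ : ℝ) (c : ℂ) : laguerreDelta θ (fun _ => c) = fun _ => 0 := by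
  funext z
  simp [laguerreDelta]

theorem laguerreDelta_const_mul_pow (θ : ℝ) (c : ℂ) (m : ℕ) :
    laguerreDelta θ (fun ζ => c * ζ ^ (m + 1)) =
      fun ζ => c * ((((m + 1 : ℕ) : ℝ) * (θ + m) : ℝ) : ℂ) * ζ ^ m := by
  have h1 : ∀ (d : ℂ) (j : ℕ), deriv (fun ζ : ℂ => d * ζ ^ j) = fun ζ => d * (j * ζ ^ (j - 1)) := by
    intro d j
    funext ζ
    rw [deriv_const_mul_field, deriv_pow_field]
  funext z
  have h2 : deriv (deriv fun ζ : ℂ => c * ζ ^ (m + 1)) z =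
      c * ((m + 1 : ℕ) : ℂ) * (m * z ^ (m - 1)) := by
    rw [h1]
    simp only [← mul_assoc c, Nat.add_sub_cancel]
    rw [h1]
  rw [laguerreDelta, h2, h1]
  cases m with
  | zero => simp [mul_comm]
  | succ m =>
    simp only [Nat.add_sub_cancel]
    push_cast
    ring

theorem laguerreDelta_iterate_const_mul_pow (θ : ℝ) (k : ℕ) (c : ℂ) (n : ℕ) :
    (laguerreDelta θ)^[k] (fun ζ => c * ζ ^ (n + k)) =
      fun ζ => c * (deltaCoeff θ n k : ℂ) * ζ ^ n := by
  induction k generalizing c with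
  | zero => simp [deltaCoeff]
  | succ k ih =>
    rw [Function.iterate_succ_apply, ← add_assoc, laguerreDelta_const_mul_pow, ih, deltaCoeff_succ]
    funext ζ
    push_cast
    ring

theorem laguerreDelta_iterate_const_mul_pow_of_lt (θ : ℝ) {k m : ℕ} (hmk : m < k) (c : ℂ) :
    (laguerreDelta θ)^[k] (fun ζ => c * ζ ^ m) = fun _ => 0 := by
  induction k generalizing c m with
  | zero => omega
  | succ k ih =>
    rw [Function.iterate_succ_apply]
    cases m with
    | zero =>
      simp only [pow_zero, laguerreDelta_const]
      exact Function.iterate_fixed (laguerreDelta_const θ 0) k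
    | succ m => rw [laguerreDelta_const_mul_pow, ih (by omega)]

/-- Replacing `θ` by the integer `M + 1` turns the product into a quotient of factorials, hence a
binomial coefficient. -/
theorem deltaCoeff_mul_factorial_le {θ : ℝ} (hθ : 0 ≤ θ) {M : ℕ} (hM : θ ≤ M + 1) (n k : ℕ) :
    deltaCoeff θ n k * n.factorial ≤
      (n + k).factorial * k.factorial * ((k + (M + n)).choose (M + n) : ℝ) := by
  have h1 : ∀ k, deltaCoeff θ n k * n.factorial * (M + n).factorial ≤
      ((n + k).factorial : ℝ) * (M + n + k).factorial := by
    intro k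
    induction k with
    | zero => simp [deltaCoeff]
    | succ k ih =>
      rw [deltaCoeff_succ, ← add_assoc, ← add_assoc, Nat.factorial_succ (n + k),
        Nat.factorial_succ (M + n + k)]
      have h2 : θ + (n + k : ℕ) ≤ ((M + n + k + 1 : ℕ) : ℝ) := by
        push_cast
        linarith
      calc deltaCoeff θ n k * (((n + k + 1 : ℕ) : ℝ) * (θ + (n + k : ℕ))) * n.factorial *
            (M + n).factorial
          = (deltaCoeff θ n k * n.factorial * (M + n).factorial) *
              (((n + k + 1 : ℕ) : ℝ) * (θ + (n + k : ℕ))) := by ring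
        _ ≤ (((n + k).factorial : ℝ) * (M + n + k).factorial) *
              (((n + k + 1 : ℕ) : ℝ) * ((M + n + k + 1 : ℕ) : ℝ)) := by gcongr
        _ = _ := by
          push_cast
          ring
  have h2 : ((k + (M + n)).choose (M + n) : ℝ) * (M + n).factorial * k.factorial =
      (M + n + k).factorial := by
    rw [add_comm k, Nat.choose_symm_add]
    exact_mod_cast Nat.add_choose_mul_factorial_mul_factorial (M + n) k
  have h3 : (0 : ℝ) < (M + n).factorial := by positivity
  refine le_of_mul_le_mul_right ((h1 k).trans (le_of_eq ?_)) h3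
  rw [← h2]
  ring

/-- The `k`-th term of the series for the `n`-th Taylor coefficient of `φ(Δ_θ) f`. -/
noncomputable def deltaTaylorTerm (θ : ℝ) (φ f : ℂ → ℂ) (n k : ℕ) : ℂ :=
  iteratedDeriv k φ 0 / k.factorial * (iteratedDeriv (n + k) f 0 / (n + k).factorial) *
    deltaCoeff θ n k

/-! ### Taylor coefficients of `φ(Δ_θ) f` -/

section Estimates

variable {θ : ℝ} {M : ℕ} {φ f : ℂ → ℂ} {A B a b : ℝ}

theorem norm_deltaTaylorTerm_le (hθ : 0 ≤ θ) (hM : θ ≤ M + 1)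
    (hφ : ∀ k, ‖iteratedDeriv k φ 0‖ ≤ A * a ^ k) (hf : ∀ k, ‖iteratedDeriv k f 0‖ ≤ B * b ^ k)
    (n k : ℕ) : ‖deltaTaylorTerm θ φ f n k‖ ≤
      A * B * (b ^ n / n.factorial) * (((k + (M + n)).choose (M + n) : ℝ) * (a * b) ^ k) := by
  have h1 := deltaCoeff_mul_factorial_le hθ hM n k
  have h2 : deltaCoeff θ n k ≤
      (n + k).factorial * k.factorial * ((k + (M + n)).choose (M + n) : ℝ) / n.factorial := by
    rwa [le_div_iff₀ (by positivity)]
  have hA : 0 ≤ A * a ^ k := (norm_nonneg _).trans (hφ k)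
  rw [deltaTaylorTerm, norm_mul, norm_mul, norm_div, norm_div, Complex.norm_real,
    Real.norm_of_nonneg (deltaCoeff_nonneg hθ n k), Complex.norm_natCast, Complex.norm_natCast]
  calc _ ≤ A * a ^ k / k.factorial * (B * b ^ (n + k) / (n + k).factorial) *
        ((n + k).factorial * k.factorial * ((k + (M + n)).choose (M + n) : ℝ) / n.factorial) := by
        have := hφ k
        have := hf (n + k)
        have := deltaCoeff_nonneg hθ n k
        have : 0 ≤ B * b ^ (n + k) := (norm_nonneg _).trans (hf (n + k))
        gcongr
    _ = _ := by
        have e1 : ((n + k).factorial : ℝ) ≠ 0 := by positivity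
        have e2 : (k.factorial : ℝ) ≠ 0 := by positivity
        have e3 : (n.factorial : ℝ) ≠ 0 := by positivity
        rw [mul_pow, pow_add]
        field_simp

variable (ha : 0 ≤ a) (hb : 0 ≤ b) (hab : a * b < 1)
include ha hb hab

/-- The negative binomial series sums to `(1 - a b)^{-(M + n + 1)}`; `n` of these factors join `b ^
n` and produce the exponent `b / (1 - a b)`. -/
theorem hasSum_deltaTaylorTerm_bound (n : ℕ) :
    HasSum (fun k => A * B * (b ^ n / n.factorial) *
      (((k + (M + n)).choose (M + n) : ℝ) * (a * b) ^ k))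
      (A * B * (1 / (1 - a * b)) ^ (M + 1) * ((b / (1 - a * b)) ^ n / n.factorial)) := by
  have h : ‖a * b‖ < 1 := by rwa [Real.norm_of_nonneg (mul_nonneg ha hb)]
  have h1 : (1 - a * b) ≠ 0 := by linarith
  have h2 : A * B * (1 / (1 - a * b)) ^ (M + 1) * ((b / (1 - a * b)) ^ n / n.factorial) =
      A * B * (b ^ n / n.factorial) * (1 / (1 - a * b) ^ (M + n + 1)) := by
    rw [div_pow, div_pow, one_pow, show M + n + 1 = M + 1 + n by ring, pow_add _ (M + 1) n]
    field_simp
  rw [h2]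
  exact (hasSum_choose_mul_geometric_of_norm_lt_one (M + n) h).mul_left _

variable (hθ : 0 ≤ θ) (hM : θ ≤ M + 1)
  (hφ : ∀ k, ‖iteratedDeriv k φ 0‖ ≤ A * a ^ k) (hf : ∀ k, ‖iteratedDeriv k f 0‖ ≤ B * b ^ k)
include hθ hM hφ hf

theorem summable_norm_deltaTaylorTerm (n : ℕ) : Summable fun k => ‖deltaTaylorTerm θ φ f n k‖ :=
  (hasSum_deltaTaylorTerm_bound ha hb hab n).summable.of_nonneg_of_le (fun _ => norm_nonneg _)
    (norm_deltaTaylorTerm_le hθ hM hφ hf n)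

theorem norm_tsum_deltaTaylorTerm_le (n : ℕ) : ‖∑' k, deltaTaylorTerm θ φ f n k‖ ≤
    A * B * (1 / (1 - a * b)) ^ (M + 1) * ((b / (1 - a * b)) ^ n / n.factorial) :=
  tsum_of_norm_bounded (hasSum_deltaTaylorTerm_bound ha hb hab n)
    (norm_deltaTaylorTerm_le hθ hM hφ hf n)

theorem summable_norm_tsum_deltaTaylorTerm {r : ℝ} (hr : 0 ≤ r) :
    Summable fun n => ‖∑' k, deltaTaylorTerm θ φ f n k‖ * r ^ n := by
  refine Summable.of_nonneg_of_le (fun n => by positivity) (fun n =>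
    mul_le_mul_of_nonneg_right (norm_tsum_deltaTaylorTerm_le ha hb hab hθ hM hφ hf n)
      (by positivity)) ?_
  refine ((Real.summable_pow_div_factorial (b / (1 - a * b) * r)).mul_left
    (A * B * (1 / (1 - a * b)) ^ (M + 1))).congr fun n => ?_
  rw [mul_pow]
  ring

theorem summable_deltaTaylorTerm_prod (z : ℂ) :
    Summable fun p : ℕ × ℕ => deltaTaylorTerm θ φ f p.1 p.2 * z ^ p.1 := by
  have hA : 0 ≤ A := (norm_nonneg _).trans ((hφ 0).trans_eq (by simp))
  have hB : 0 ≤ B := (norm_nonneg _).trans ((hf 0).trans_eq (by simp))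
  set u : ℕ × ℕ → ℝ := fun p => A * B * (b ^ p.1 / p.1.factorial) *
      (((p.2 + (M + p.1)).choose (M + p.1) : ℝ) * (a * b) ^ p.2) * ‖z‖ ^ p.1
  have hu : ∀ p, 0 ≤ u p := fun p => by positivity
  have hrow : ∀ n, HasSum (fun k => u (n, k))
      (A * B * (1 / (1 - a * b)) ^ (M + 1) * ((b / (1 - a * b)) ^ n / n.factorial) * ‖z‖ ^ n) :=
    fun n => (hasSum_deltaTaylorTerm_bound ha hb hab n).mul_right _
  have husum : Summable u := by
    refine (summable_prod_of_nonneg hu).2 ⟨fun n => (hrow n).summable, ?_⟩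
    simp only [(hrow _).tsum_eq]
    refine ((Real.summable_pow_div_factorial (b / (1 - a * b) * ‖z‖)).mul_left
      (A * B * (1 / (1 - a * b)) ^ (M + 1))).congr fun n => ?_
    rw [mul_pow]
    ring
  refine husum.of_norm_bounded fun p => ?_
  rw [norm_mul, norm_pow]
  exact mul_le_mul_of_nonneg_right (norm_deltaTaylorTerm_le hθ hM hφ hf _ _) (by positivity)

omit ha hb hab hθ hM hφ hf in
-- Substituting `m = n + k` groups the double series by powers of `z`; the omitted terms `m < k`
-- vanish.
theorem deltaSeriesTerm_shift (z : ℂ) (p : ℕ × ℕ) :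
    deltaSeriesTerm θ φ f z (p.2, p.1 + p.2) = deltaTaylorTerm θ φ f p.1 p.2 * z ^ p.1 := by
  have h := laguerreDelta_iterate_const_mul_pow θ p.2 1 p.1
  simp only [one_mul] at h
  rw [deltaSeriesTerm, h, deltaTaylorTerm]
  ring

omit ha hb hab hθ hM hφ hf in
theorem support_deltaSeriesTerm_subset (z : ℂ) :
    Function.support (deltaSeriesTerm θ φ f z) ⊆
      Set.range fun p : ℕ × ℕ => (p.2, p.1 + p.2) := by
  rintro ⟨k, m⟩ h
  by_cases hkm : k ≤ m
  · exact ⟨(m - k, k), by simp [Nat.sub_add_cancel hkm]⟩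
  · refine absurd ?_ h
    have h := laguerreDelta_iterate_const_mul_pow_of_lt θ (not_le.1 hkm) 1
    simp only [one_mul] at h
    rw [deltaSeriesTerm, h, mul_zero]

omit ha hb hab hθ hM hφ hf in
theorem injective_shift : Function.Injective fun p : ℕ × ℕ => (p.2, p.1 + p.2) := by
  rintro ⟨n, k⟩ ⟨n', k'⟩ h
  simp only [Prod.mk.injEq] at h ⊢
  omega

theorem summable_deltaSeriesTerm (z : ℂ) : Summable (deltaSeriesTerm θ φ f z) := by
  rw [← injective_shift.summable_iff fun x hx => by
    by_contra h
    exact hx (support_deltaSeriesTerm_subset z h)]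
  exact (summable_deltaTaylorTerm_prod ha hb hab hθ hM hφ hf z).congr fun p =>
    (deltaSeriesTerm_shift z p).symm

theorem deltaApply_eq_tsum (z : ℂ) :
    deltaApply θ φ f z = ∑' n, (∑' k, deltaTaylorTerm θ φ f n k) * z ^ n := by
  rw [deltaApply, ← injective_shift.tsum_eq (support_deltaSeriesTerm_subset z)]
  simp only [deltaSeriesTerm_shift]
  rw [(summable_deltaTaylorTerm_prod ha hb hab hθ hM hφ hf z).tsum_prod]
  simp only [tsum_mul_right]

theorem differentiable_deltaApply : Differentiable ℂ (deltaApply θ φ f) :=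
  differentiable_of_eq_tsum
    (fun _ hr => summable_norm_tsum_deltaTaylorTerm ha hb hab hθ hM hφ hf hr)
    (deltaApply_eq_tsum ha hb hab hθ hM hφ hf)

theorem norm_iteratedDeriv_deltaApply_le (n : ℕ) : ‖iteratedDeriv n (deltaApply θ φ f) 0‖ ≤
    A * B * (1 / (1 - a * b)) ^ (M + 1) * (b / (1 - a * b)) ^ n := by
  rw [iteratedDeriv_of_eq_tsum
    (fun _ hr => summable_norm_tsum_deltaTaylorTerm ha hb hab hθ hM hφ hf hr)
    (deltaApply_eq_tsum ha hb hab hθ hM hφ hf), norm_mul, Complex.norm_natCast]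
  have h := norm_tsum_deltaTaylorTerm_le ha hb hab hθ hM hφ hf n
  rwa [mul_div_assoc', le_div_iff₀ (by positivity), mul_comm] at h

/-- The polynomials `P_N(Δ_θ) Q_N` have nonpositive zeros, and their nonnegative coefficients
converge to, and are dominated by, those of `φ(Δ_θ) f` up to a constant. -/
theorem deltaApply_mem_laguerreEntire (hφL : φ ∈ laguerreEntire) (hfL : f ∈ laguerreEntire) :
    deltaApply θ φ f ∈ laguerreEntire := by
  obtain ⟨K₁, c₁, P, hP, hPle, hPlim, hφc⟩ := exists_affineProducts_approx hφL
  obtain ⟨K₂, c₂, Q, hQ, hQle, hQlim, hfc⟩ := exists_affineProducts_approx hfL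
  have hP0 : ∀ N n, 0 ≤ (P N).coeff n := fun N => coeff_nonneg_of_mem_affineProducts (hP N)
  have hQ0 : ∀ N n, 0 ≤ (Q N).coeff n := fun N => coeff_nonneg_of_mem_affineProducts (hQ N)
  have hc₁ : ∀ n, 0 ≤ c₁ n := fun n => (hP0 0 n).trans (hPle 0 n)
  have hc₂ : ∀ n, 0 ≤ c₂ n := fun n => (hQ0 0 n).trans (hQle 0 n)
  have hd := deltaCoeff_nonneg hθ
  have hterm : ∀ n k, deltaTaylorTerm θ φ f n k =
      K₁ * K₂ * ((c₁ k * c₂ (n + k) * deltaCoeff θ n k : ℝ) : ℂ) := by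
    intro n k
    rw [deltaTaylorTerm, hφc, hfc,
      mul_div_cancel_left₀ _ (Nat.cast_ne_zero.2 (Nat.factorial_ne_zero k)),
      mul_div_cancel_left₀ _ (Nat.cast_ne_zero.2 (Nat.factorial_ne_zero (n + k)))]
    push_cast
    ring
  have hdiff := differentiable_deltaApply ha hb hab hθ hM hφ hf
  -- Summability of the real coefficients is recovered below by dividing by `‖K₁ * K₂‖`, so the zero
  -- function is treated apart.
  by_cases hK : K₁ * K₂ = 0
  · refine ⟨hdiff, 0, 0, 0, 0, le_rfl, antitone_const, fun _ => le_rfl, summable_zero, fun z => ?_⟩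
    rw [deltaApply_eq_tsum ha hb hab hθ hM hφ hf]
    simp [hterm, hK]
  have hKn : ‖K₁ * K₂‖ ≠ 0 := norm_ne_zero_iff.2 hK
  have hcnn : ∀ n k, 0 ≤ c₁ k * c₂ (n + k) * deltaCoeff θ n k := fun n k =>
    mul_nonneg (mul_nonneg (hc₁ _) (hc₂ _)) (hd _ _)
  have hsum : ∀ n, Summable fun k => c₁ k * c₂ (n + k) * deltaCoeff θ n k := by
    intro n
    refine ((summable_norm_deltaTaylorTerm ha hb hab hθ hM hφ hf n).mul_left
      ‖K₁ * K₂‖⁻¹).congr fun k => ?_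
    rw [hterm, norm_mul (K₁ * K₂) (Complex.ofReal _), Complex.norm_real, Real.norm_of_nonneg (hcnn n k),
      inv_mul_cancel_left₀ hKn]
  set c : ℕ → ℝ := fun n => ∑' k, c₁ k * c₂ (n + k) * deltaCoeff θ n k
  have hc : ∀ n, ∑' k, deltaTaylorTerm θ φ f n k = K₁ * K₂ * c n := by
    intro n
    simp only [hterm]
    rw [tsum_mul_left, ← Complex.ofReal_tsum]
  have hc0 : ∀ n, 0 ≤ c n := fun n => tsum_nonneg (hcnn n)
  have hle : ∀ N n k, (P N).coeff k * (Q N).coeff (n + k) * deltaCoeff θ n k ≤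
      c₁ k * c₂ (n + k) * deltaCoeff θ n k := fun N n k =>
    mul_le_mul_of_nonneg_right
      (mul_le_mul (hPle _ _) (hQle _ _) (hQ0 _ _) (hc₁ _)) (hd _ _)
  have hnn : ∀ N n k, 0 ≤ (P N).coeff k * (Q N).coeff (n + k) * deltaCoeff θ n k := fun N n k =>
    mul_nonneg (mul_nonneg (hP0 _ _) (hQ0 _ _)) (hd _ _)
  refine mem_laguerreEntire_of_tendsto (P := fun N => aeval (polyDelta θ) (P N) (Q N)) (c := c)
    (K := K₁ * K₂) ?_ ?_ ?_ ?_ ?_ hdiff ?_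
  · exact fun N => aeval_polyDelta_of_mem_affineProducts hθ (hP N) _
      (zero_or_nonposRooted_of_mem_affineProducts (hQ N))
  · intro N n
    rw [coeff_aeval_polyDelta]
    exact tsum_nonneg (hnn N n)
  · intro N n
    rw [coeff_aeval_polyDelta]
    exact ((hsum n).of_nonneg_of_le (hnn N n) (hle N n)).tsum_le_tsum (hle N n) (hsum n)
  · intro n
    simp only [coeff_aeval_polyDelta]
    refine tendsto_tsum_of_dominated_convergence (hsum n)
      (fun k => ((hPlim k).mul (hQlim (n + k))).mul_const _) (Eventually.of_forall fun N k => ?_)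
    rw [Real.norm_of_nonneg (hnn N n k)]
    exact hle N n k
  · intro r hr
    refine ((summable_norm_tsum_deltaTaylorTerm ha hb hab hθ hM hφ hf hr).mul_left
      ‖K₁ * K₂‖⁻¹).congr fun n => ?_
    rw [hc, norm_mul (K₁ * K₂) (c n : ℂ), Complex.norm_real, Real.norm_of_nonneg (hc0 n), mul_assoc,
      inv_mul_cancel_left₀ hKn]
  · intro z
    rw [deltaApply_eq_tsum ha hb hab hθ hM hφ hf, ← tsum_mul_left]
    refine tsum_congr fun n => ?_
    rw [hc, mul_assoc]

end Estimates

/-! ### Norm bounds and continuity -/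

theorem norm_iteratedDeriv_le_of_expNorm_lt_top {b : ℝ} (hb : 0 < b) {f : ℂ → ℂ}
    (hf : expNorm b f < ∞) (k : ℕ) : ‖iteratedDeriv k f 0‖ ≤ (expNorm b f).toReal * b ^ k := by
  have h : ‖iteratedDeriv k f 0‖ₑ / ENNReal.ofReal b ^ k ≤ expNorm b f :=
    le_iSup (fun k : ℕ => ‖iteratedDeriv k f 0‖ₑ / ENNReal.ofReal b ^ k) k
  have h2 := ENNReal.toReal_mono hf.ne h
  rw [ENNReal.toReal_div, ENNReal.toReal_pow, ENNReal.toReal_ofReal hb.le, toReal_enorm] at h2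
  rwa [div_le_iff₀ (by positivity)] at h2

theorem expNorm_le_ofReal {b : ℝ} (hb : 0 < b) {f : ℂ → ℂ} {K : ℝ}
    (hf : ∀ k, ‖iteratedDeriv k f 0‖ ≤ K * b ^ k) : expNorm b f ≤ ENNReal.ofReal K := by
  refine iSup_le fun k => ?_
  rw [← ENNReal.ofReal_pow hb.le, ← ofReal_norm, ← ENNReal.ofReal_div_of_pos (by positivity)]
  refine ENNReal.ofReal_le_ofReal ?_
  rw [div_le_iff₀ (by positivity)]
  exact hf k

/-- Membership in `𝓐_a` controls only norms with exponent above `a`; continuity of `b / (1 - a b)`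
leaves room to enlarge both exponents, which also makes them positive. -/
theorem exists_larger_exponents {a b c : ℝ} (ha : 0 ≤ a) (hb : 0 ≤ b) (hab : a * b < 1)
    (hc : b * (1 - a * b)⁻¹ < c) :
    ∃ a' b' : ℝ, a < a' ∧ b < b' ∧ 0 < a' ∧ 0 < b' ∧ a' * b' < 1 ∧ b' / (1 - a' * b') ≤ c := by
  have h0 : 1 - a * b ≠ 0 := by linarith
  have h1 : ContinuousAt (fun t : ℝ => (a + t) * (b + t)) 0 := by fun_prop
  have h2 : ContinuousAt (fun t : ℝ => (b + t) / (1 - (a + t) * (b + t))) 0 :=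
    ContinuousAt.div (by fun_prop) (by fun_prop) (by simpa using h0)
  have e1 : ∀ᶠ t in 𝓝 (0 : ℝ), (a + t) * (b + t) < 1 :=
    h1.eventually_lt_const (by simpa using hab)
  have e2 : ∀ᶠ t in 𝓝 (0 : ℝ), (b + t) / (1 - (a + t) * (b + t)) < c :=
    h2.eventually_lt_const (by simpa [div_eq_mul_inv] using hc)
  obtain ⟨t, ⟨h3, h4⟩, h5⟩ := (((e1.and e2).filter_mono nhdsWithin_le_nhds).and
    (self_mem_nhdsWithin (s := Set.Ioi (0 : ℝ)))).exists
  have h5 : 0 < t := h5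
  exact ⟨a + t, b + t, by linarith, by linarith, by linarith, by linarith, h3, h4.le⟩

namespace ExpSpace

variable {θ a b : ℝ}

theorem exists_growth (ha : 0 ≤ a) (hb : 0 ≤ b) (hab : a * b < 1) (φ : ExpSpace a)
    (f : ExpSpace b) : ∃ A B a' b' : ℝ, 0 ≤ a' ∧ 0 ≤ b' ∧ a' * b' < 1 ∧
      (∀ k, ‖iteratedDeriv k φ.toFun 0‖ ≤ A * a' ^ k) ∧
      ∀ k, ‖iteratedDeriv k f.toFun 0‖ ≤ B * b' ^ k := by
  obtain ⟨a', b', haa, hbb, ha', hb', hab', -⟩ :=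
    exists_larger_exponents ha hb hab (lt_add_one _)
  exact ⟨_, _, a', b', ha'.le, hb'.le, hab',
    norm_iteratedDeriv_le_of_expNorm_lt_top ha' (φ.expNorm_lt_top haa),
    norm_iteratedDeriv_le_of_expNorm_lt_top hb' (f.expNorm_lt_top hbb)⟩

theorem summable_deltaSeriesTerm (hθ : 0 ≤ θ) (ha : 0 ≤ a) (hb : 0 ≤ b) (hab : a * b < 1)
    (φ : ExpSpace a) (f : ExpSpace b) (z : ℂ) :
    Summable (deltaSeriesTerm θ φ.toFun f.toFun z) := by
  obtain ⟨A, B, a', b', ha', hb', hab', hφ, hf⟩ := exists_growth ha hb hab φ f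
  exact _root_.summable_deltaSeriesTerm ha' hb' hab' hθ
    ((Nat.le_ceil θ).trans (by linarith)) hφ hf z

theorem expNorm_deltaApply_le (hθ : 0 ≤ θ) {a' b' c : ℝ} (ha : a < a') (hb : b < b')
    (ha' : 0 < a') (hb' : 0 < b') (hab' : a' * b' < 1) (hc : b' / (1 - a' * b') ≤ c)
    (φ : ExpSpace a) (f : ExpSpace b) :
    expNorm c (deltaApply θ φ.toFun f.toFun) ≤ ENNReal.ofReal
      ((1 / (1 - a' * b')) ^ (⌈θ⌉₊ + 1) *
        ((expNorm a' φ.toFun).toReal * (expNorm b' f.toFun).toReal)) := by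
  have h1 : 0 < 1 - a' * b' := by linarith
  have h2 : 0 < b' / (1 - a' * b') := div_pos hb' h1
  refine expNorm_le_ofReal (h2.trans_le hc) fun k => ?_
  refine (norm_iteratedDeriv_deltaApply_le ha'.le hb'.le hab' hθ
    ((Nat.le_ceil θ).trans (by linarith))
    (norm_iteratedDeriv_le_of_expNorm_lt_top ha' (φ.expNorm_lt_top ha))
    (norm_iteratedDeriv_le_of_expNorm_lt_top hb' (f.expNorm_lt_top hb)) k).trans ?_
  rw [mul_comm ((1 / (1 - a' * b')) ^ _)]
  gcongr

/-- The bilinear map `(φ, f) ↦ φ(Δ_θ) f` from `𝓐_a × 𝓐_b` to `𝓐_c`, `c = b (1 - a b)⁻¹`. -/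
noncomputable def deltaMap (hθ : 0 ≤ θ) (ha : 0 ≤ a) (hb : 0 ≤ b) (hab : a * b < 1)
    (φ : ExpSpace a) (f : ExpSpace b) : ExpSpace (b * (1 - a * b)⁻¹) :=
  ⟨deltaApply θ φ.toFun f.toFun, by
    obtain ⟨A, B, a', b', ha', hb', hab', hφ, hf⟩ := exists_growth ha hb hab φ f
    refine ⟨differentiable_deltaApply ha' hb' hab' hθ
      ((Nat.le_ceil θ).trans (by linarith)) hφ hf, fun c hc => ?_⟩
    obtain ⟨a', b', haa, hbb, ha', hb', hab', hc'⟩ := exists_larger_exponents ha hb hab hc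
    exact (expNorm_deltaApply_le hθ haa hbb ha' hb' hab' hc' φ f).trans_lt ENNReal.ofReal_lt_top⟩

theorem deltaMap_mem_laguerreExp (hθ : 0 ≤ θ) (ha : 0 ≤ a) (hb : 0 ≤ b) (hab : a * b < 1)
    {φ : ExpSpace a} {f : ExpSpace b} (hφ : φ ∈ laguerreExp a) (hf : f ∈ laguerreExp b) :
    deltaMap hθ ha hb hab φ f ∈ laguerreExp (b * (1 - a * b)⁻¹) := by
  obtain ⟨A, B, a', b', ha', hb', hab', hφ', hf'⟩ := exists_growth ha hb hab φ f
  exact deltaApply_mem_laguerreEntire ha' hb' hab' hθ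
    ((Nat.le_ceil θ).trans (by linarith)) hφ' hf' hφ hf

theorem iteratedDeriv_sub (f g : ExpSpace a) (k : ℕ) :
    iteratedDeriv k (f - g).toFun 0 = iteratedDeriv k f.toFun 0 - iteratedDeriv k g.toFun 0 :=
  _root_.iteratedDeriv_sub f.differentiable_toFun.contDiff.contDiffAt
    g.differentiable_toFun.contDiff.contDiffAt

/-- Bilinearity, in the only form continuity needs; absolute convergence justifies combining the
series. -/
theorem deltaMap_sub_deltaMap (hθ : 0 ≤ θ) (ha : 0 ≤ a) (hb : 0 ≤ b) (hab : a * b < 1)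
    (φ φ₀ : ExpSpace a) (f f₀ : ExpSpace b) :
    deltaMap hθ ha hb hab φ f - deltaMap hθ ha hb hab φ₀ f₀ =
      deltaMap hθ ha hb hab (φ - φ₀) f + deltaMap hθ ha hb hab φ₀ (f - f₀) := by
  have hs := summable_deltaSeriesTerm hθ ha hb hab
  refine Subtype.ext (funext fun z => ?_)
  change deltaApply θ φ.toFun f.toFun z - deltaApply θ φ₀.toFun f₀.toFun z =
    deltaApply θ (φ - φ₀).toFun f.toFun z + deltaApply θ φ₀.toFun (f - f₀).toFun z
  rw [deltaApply, deltaApply, deltaApply, deltaApply, ← (hs φ f z).tsum_sub (hs φ₀ f₀ z),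
    ← (hs (φ - φ₀) f z).tsum_add (hs φ₀ (f - f₀) z)]
  refine tsum_congr fun p => ?_
  rw [deltaSeriesTerm, deltaSeriesTerm, deltaSeriesTerm, deltaSeriesTerm, iteratedDeriv_sub,
    iteratedDeriv_sub]
  ring

theorem continuous_deltaMap (hθ : 0 ≤ θ) (ha : 0 ≤ a) (hb : 0 ≤ b) (hab : a * b < 1) :
    Continuous fun p : ExpSpace a × ExpSpace b => deltaMap hθ ha hb hab p.1 p.2 := by
  have := (withSeminorms a).topologicalAddGroup
  have := (withSeminorms b).topologicalAddGroup
  refine continuous_iff_continuousAt.2 fun ⟨φ₀, f₀⟩ => ?_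
  refine ((withSeminorms _).tendsto_nhds _ _).2 fun ⟨c, hc⟩ ε hε => ?_
  obtain ⟨a', b', haa, hbb, ha', hb', hab', hc'⟩ := exists_larger_exponents ha hb hab hc
  set K : ℝ := (1 / (1 - a' * b')) ^ (⌈θ⌉₊ + 1)
  have hK : 0 ≤ K := pow_nonneg (one_div_nonneg.2 (by linarith)) _
  set p := seminorms a ⟨a', haa⟩
  set q := seminorms b ⟨b', hbb⟩
  have hp : Continuous p := (withSeminorms a).continuous_seminorm _
  have hq : Continuous q := (withSeminorms b).continuous_seminorm _
  have hbound : ∀ (φ : ExpSpace a) (f : ExpSpace b),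
      seminorms _ ⟨c, hc⟩ (deltaMap hθ ha hb hab φ f) ≤ K * (p φ * q f) := fun φ f =>
    ENNReal.toReal_le_of_le_ofReal
      (mul_nonneg hK (mul_nonneg (apply_nonneg p φ) (apply_nonneg q f)))
      (expNorm_deltaApply_le hθ haa hbb ha' hb' hab' hc' φ f)
  have hcont : Continuous fun x : ExpSpace a × ExpSpace b =>
      K * (p (x.1 - φ₀) * q x.2) + K * (p φ₀ * q (x.2 - f₀)) := by
    fun_prop
  -- The continuous majorant vanishes at `(φ₀, f₀)`, since `p 0 = q 0 = 0`.
  have hlim := hcont.continuousAt (x := (φ₀, f₀))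
  filter_upwards [hlim.eventually_lt_const (u := ε) (by simpa using hε)] with x hx
  rw [deltaMap_sub_deltaMap]
  exact ((map_add_le_add _ _ _).trans (add_le_add (hbound _ _) (hbound _ _))).trans_lt hx

end ExpSpace

theorem theorem3 (θ a b : ℝ) (hθ : 0 ≤ θ) (ha : 0 ≤ a) (hb : 0 ≤ b) (hab : a * b < 1) :
    (∀ (φ : laguerreExp a) (f : laguerreExp b) (z : ℂ),
      Summable (deltaSeriesTerm θ φ.1.toFun f.1.toFun z)) ∧
    ∃ T : laguerreExp a × laguerreExp b → laguerreExp (b * (1 - a * b)⁻¹),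
      (∀ (φ : laguerreExp a) (f : laguerreExp b) (z : ℂ),
        (T (φ, f)).1.toFun z = deltaApply θ φ.1.toFun f.1.toFun z) ∧
      Continuous T := by
  refine ⟨fun φ f z => ExpSpace.summable_deltaSeriesTerm hθ ha hb hab φ.1 f.1 z,
    fun p => ⟨ExpSpace.deltaMap hθ ha hb hab p.1.1 p.2.1,
      ExpSpace.deltaMap_mem_laguerreExp hθ ha hb hab p.1.2 p.2.2⟩, fun _ _ _ => rfl, ?_⟩
  exact ((ExpSpace.continuous_deltaMap hθ ha hb hab).comp
    (continuous_subtype_val.prodMap continuous_subtype_val)).subtype_mk _
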